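/- Let $M$ be a compact metric space and let $\mathfrak m$ be a Borel probability measure on $M$ with full topological support (for instance, $M$ a compact subset of a complete Riemannian manifold and $\mathfrak m$ an absolutely continuous probability measure with support $M$). Let $\mathcal P(M)$ be the space of Borel probability measures on $M$ with the weak topology. For $\beta>0$, the Dirichlet–Ferguson measure with intensity $\beta\mathfrak m$ is the probability measure $\mathbb Q^\beta$ on $\mathcal P(M)$ such that, for every finite measurable partition $M=\dot\bigcup_{i=1}^N M_i$, the random vector $(\nu(M_1),\dots,\nu(M_N))$ has under $\mathbb Q^\beta(d\nu)$ the Dirichlet distribution with parameters $(\beta\mathfrak m(M_1),\dots,\beta\mathfrak m(M_N))$. That is, if all $\mathfrak m(M_i)>0$, then with $x_N=1-\sum_{i<N}x_i$ its law on the simplex has the density $\frac{\Gamma(\beta)}{\prod_i\Gamma(\beta\mathfrak m(M_i))}\prod_{i=1}^N x_i^{\beta\mathfrak m(M_i)-1}$ with respect to $dx_1\cdots dx_{N-1}$, and $\nu(A)=0$ for $\mathbb Q^\beta$-a.e. $\nu$ whenever $\mathfrak m(A)=0$. Let $\mathrm{Ent}(\mu\mid\nu)=\int \log\frac{d\mu}{d\nu}\,d\mu$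 if $\mu\ll\nu$, and $+\infty$ otherwise. Then $\mathbb Q^\beta$ exists and is unique for every $\beta>0$, and the measures $\mathbb Q^\beta$ satisfy, as $\beta\to\infty$, a large deviation principle on $\mathcal P(M)$ with speed $\beta$ and rate function $$I(\nu):=\mathrm{Ent}(\mathfrak m\mid\nu).$$ That is, $I$ is lower semicontinuous with values in $[0,\infty]$; for every closed set $F\subset\mathcal P(M)$, $$\limsup_{\beta\to\infty}\frac1\beta\log\mathbb Q^\beta(F)\le-\inf_{\nu\in F}I(\nu),$$ and for every open set $G\subset\mathcal P(M)$, $$\liminf_{\beta\to\infty}\frac1\beta\log\mathbb Q^\beta(G)\ge-\inf_{\nu\in G}I(\nu),$$ with the conventions $\log 0=-\infty$ and $\inf\emptyset=+\infty$. -/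

import Mathlib

open MeasureTheory Filter
open scoped ENNReal Topology

noncomputable section

/-- The Dirichlet distribution with positive parameters `α 0, …, α n`, through its density
`Γ(∑ α i) / ∏ Γ(α i) * ∏ x i ^ (α i - 1)` on the standard simplex: the first `n` coordinates are
integrated against Lebesgue measure and the last one is `1 - ∑ x i`. -/
def dirichletDistribution {n : ℕ} (α : Fin (n + 1) → ℝ) : Measure (Fin (n + 1) → ℝ) :=
  (((volume : Measure (Fin n → ℝ)).restrict
      {x : Fin n → ℝ | (∀ i, 0 ≤ x i) ∧ ∑ i, x i ≤ 1}).withDensity fun x =>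
    ENNReal.ofReal
      (Real.Gamma (∑ i, α i) / (∏ i, Real.Gamma (α i)) *
        ((∏ i : Fin n, x i ^ (α i.castSucc - 1)) *
          (1 - ∑ i, x i) ^ (α (Fin.last n) - 1)))).map
    fun x => (Fin.snoc x (1 - ∑ i, x i) : Fin (n + 1) → ℝ)

/-- `Q` is the Dirichlet–Ferguson measure with intensity `β • m`: for every finite measurable
partition `A 0, …, A n` of `M`, the random vector `(ν (A 0), …, ν (A n))` has, under `Q`, the
Dirichlet distribution with parameters `β * m (A i)`. Cells of `m`-measure zero (a Dirichlet
distribution with a zero parameter is the one whose corresponding coordinate vanishes almost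
surely) are taken care of by the second field. -/
structure IsDirichletFerguson {M : Type*} [MeasurableSpace M] (m : Measure M) (β : ℝ)
    (Q : Measure (ProbabilityMeasure M)) : Prop where
  map_partition : ∀ (n : ℕ) (A : Fin (n + 1) → Set M),
    (∀ i, MeasurableSet (A i)) → Pairwise (fun i j => Disjoint (A i) (A j)) →
    (⋃ i, A i) = Set.univ → (∀ i, 0 < m.real (A i)) →
    Q.map (fun (ν : ProbabilityMeasure M) (i : Fin (n + 1)) => (ν : Measure M).real (A i)) =
      dirichletDistribution fun i => β * m.real (A i)
  ae_null : ∀ A : Set M, MeasurableSet A → m A = 0 →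
    ∀ᵐ ν : ProbabilityMeasure M ∂Q, (ν : Measure M) A = 0

/-- The family `Q β` satisfies, as `β → ∞`, the large deviation principle with speed `β` and
rate function `I`. The values are extended reals, with `log 0 = -∞` and `inf ∅ = +∞`. -/
structure SatisfiesLDP {X : Type*} [TopologicalSpace X] [MeasurableSpace X]
    (Q : ℝ → Measure X) (I : X → ℝ≥0∞) : Prop where
  lowerSemicontinuous : LowerSemicontinuous I
  upper_bound : ∀ F : Set X, IsClosed F →
    limsup (fun β : ℝ => ((1 / β : ℝ) : EReal) * ENNReal.log (Q β F)) atTop ≤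
      -(⨅ ν ∈ F, (I ν : EReal))
  lower_bound : ∀ G : Set X, IsOpen G →
    -(⨅ ν ∈ G, (I ν : EReal)) ≤
      liminf (fun β : ℝ => ((1 / β : ℝ) : EReal) * ENNReal.log (Q β G)) atTop

end

/-! The proof rests on the Markov–Krein identity ∫ (∫ f dν)^(-β) Q(dν) = exp (-β ∫ log f dm) for
positive f. For a finite partition it expresses that independent gamma variables split into their
total and a Dirichlet vector (`lintegral_dirichletDistribution_rpow`). For continuous f it
determines Q: averaging over a gamma variable t turns exp (-t ∫ f dν) into such powers, and these
exponentials are closed under products and separate points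
(`measure_probabilityMeasure_ext_of_integral_rpow`). This gives uniqueness. Existence comes from
compactness of P(P(M)), as the identity survives weak limits of discretised Dirichlet laws
(`exists_satisfiesMarkovKrein`); uniqueness on a finite space then recovers the laws on partitions.

Since Ent(m|ν) is the supremum over f of ∫ log f dm - log ∫ f dν, the entropy is lower
semicontinuous. By the identity and Markov's inequality, the set where one of these functionals
exceeds a has mass at most exp (-βa). Finitely many such sets cover a closed set, which is the upper
bound.

For the lower bound, let p and q be the masses that m and ν give to the cells of a fine partition.
The Dirichlet law with parameters βp is the one with parameters p tilted by exp ((β - 1) ∑ p log z).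
Gibbs' inequality bounds the normalising constant from below, without Stirling asymptotics
(`exp_le_dirichletConst_div`). The cost of being near q is then about ∑ p log (p / q) ≤ Ent(m|ν). -/

/-! ### Borel structure of the space of probability measures -/

instance instPolishSpaceOfCompactMetrizable {X : Type*} [TopologicalSpace X] [CompactSpace X]
    [TopologicalSpace.MetrizableSpace X] : PolishSpace X := by
  let := TopologicalSpace.metrizableSpaceMetric X
  infer_instance

/-- The Giry σ-algebra on the probability measures of a compact metrizable space is the Borel
σ-algebra of the weak topology. -/
instance ProbabilityMeasure.instBorelSpaceOfCompact {M : Type*} [TopologicalSpace M]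
    [CompactSpace M] [TopologicalSpace.MetrizableSpace M] [MeasurableSpace M] [BorelSpace M] :
    BorelSpace (ProbabilityMeasure M) := by
  constructor
  apply le_antisymm
  -- Closed sets suffice, being a generating π-system, and ν(F) is a limit of integrals of
  -- continuous functions against ν.
  · have hcoe : @Measurable _ _ (borel (ProbabilityMeasure M)) _
        (fun ν : ProbabilityMeasure M => (ν : Measure M)) := by
      let : MeasurableSpace (ProbabilityMeasure M) := borel _
      have : BorelSpace (ProbabilityMeasure M) := ⟨rfl⟩
      refine Measurable.measure_of_isPiSystem_of_isProbabilityMeasure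
        (S := {s | IsClosed s}) (by rw [BorelSpace.measurable_eq (α := M),
          borel_eq_generateFrom_isClosed]) isPiSystem_isClosed ?_
      intro F (hF : IsClosed F)
      let := TopologicalSpace.metrizableSpaceMetric M
      have hlim : Tendsto (fun n (ν : ProbabilityMeasure M) =>
          ∫⁻ x, hF.apprSeq n x ∂(ν : Measure M)) atTop (𝓝 fun ν => (ν : Measure M) F) := by
        rw [tendsto_pi_nhds]
        exact fun ν => HasOuterApproxClosed.tendsto_lintegral_apprSeq hF _
      refine measurable_of_tendsto_metrizable (fun n => ?_) hlim
      exact (ProbabilityMeasure.continuous_lintegral_boundedContinuousFunction _).measurable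
    exact hcoe.comap_le
  · have hb := borel_eq_generateFrom_of_subbasis (α := ProbabilityMeasure M)
      (s := {U | ∃ (f : C(M, NNReal)) (V : Set ℝ≥0∞), IsOpen V ∧
        U = (fun ν : ProbabilityMeasure M => ∫⁻ x, f x ∂(ν : Measure M)) ⁻¹' V}) ?_
    · rw [hb]
      apply MeasurableSpace.generateFrom_le
      rintro _ ⟨f, V, hV, rfl⟩
      refine measurableSet_preimage ?_ hV.measurableSet
      exact (Measure.measurable_lintegral (by fun_prop)).comp measurable_subtype_coe
    · apply le_antisymm
      · apply le_generateFrom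
        rintro _ ⟨f, V, hV, rfl⟩
        exact hV.preimage (ProbabilityMeasure.continuous_lintegral_continuousMap f)
      · rw [← continuous_id_iff_le,
          @ProbabilityMeasure.continuous_iff_forall_continuousMap_continuous_lintegral]
        intro f
        rw [continuous_def]
        exact fun V hV => TopologicalSpace.isOpen_generateFrom_of_mem ⟨f, V, hV, rfl⟩

/-! ### Fine partitions and approximation by continuous functions -/

/-- A compact metric space with a measure of full support has, for every `ε > 0`, a finite
measurable partition into cells of positive measure that lie within `ε` of chosen points. The
partition is given by the map sending a point to the index of its cell. -/
lemma exists_measurable_index {M : Type*} [MetricSpace M] [CompactSpace M] [Nonempty M]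
    [MeasurableSpace M] [BorelSpace M] (m : Measure M) [IsFiniteMeasure m] [m.IsOpenPosMeasure]
    {ε : ℝ} (hε : 0 < ε) :
    ∃ (n : ℕ) (a : M → Fin (n + 1)) (p : Fin (n + 1) → M), Measurable a ∧
      (∀ x, dist x (p (a x)) ≤ ε) ∧ ∀ i, 0 < m.real (a ⁻¹' {i}) := by
  classical
  let P : Finset M → Prop := fun s => ⋃ x ∈ s, Metric.closedBall x ε = Set.univ
  obtain ⟨s₀, hs₀⟩ : ∃ s, P s := by
    obtain ⟨t, -, ht, htc⟩ := (isCompact_univ (X := M)).finite_cover_balls hε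
    refine ⟨ht.toFinset, Set.eq_univ_of_univ_subset (htc.trans ?_)⟩
    simp only [Set.Finite.mem_toFinset]
    exact Set.iUnion₂_mono fun x _ => Metric.ball_subset_closedBall
  -- In a minimal cover no ball is redundant; this is what makes every cell below have positive
  -- mass.
  obtain ⟨s, -, hs⟩ := exists_minimal_le_of_wellFoundedLT P s₀ hs₀
  have hcov : ∀ y, ∃ x ∈ s, dist y x ≤ ε := fun y => by
    have : y ∈ ⋃ x ∈ s, Metric.closedBall x ε := by rw [hs.1]; trivial
    simpa using this
  have hne : s.card ≠ 0 := by
    obtain ⟨y⟩ := ‹Nonempty M›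
    obtain ⟨x, hx, -⟩ := hcov y
    exact Finset.card_ne_zero_of_mem hx
  obtain ⟨n, hn⟩ := Nat.exists_eq_succ_of_ne_zero hne
  let e : s ≃ Fin (n + 1) := s.equivFinOfCardEq hn
  let p : Fin (n + 1) → M := fun i => (e.symm i : M)
  have hp : ∀ y, ∃ i, dist y (p i) ≤ ε := fun y => by
    obtain ⟨x, hx, hd⟩ := hcov y
    exact ⟨e ⟨x, hx⟩, by simpa [p] using hd⟩
  let a : M → Fin (n + 1) := fun y => Fin.find (fun i => dist y (p i) ≤ ε) (hp y)
  have ha : ∀ y, dist y (p (a y)) ≤ ε := fun y => Fin.find_spec (hp y)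
  refine ⟨n, a, p, ?_, ha, fun i => ?_⟩
  · refine measurable_to_countable' fun i => ?_
    have : a ⁻¹' {i} = Metric.closedBall (p i) ε \ ⋃ j : Fin (n + 1), ⋃ _ : j < i,
        Metric.closedBall (p j) ε := by
      ext y
      simp [a, Fin.find_eq_iff]
    rw [this]
    measurability
  -- The points outside all the other closed balls form an open set inside cell i, nonempty by
  -- minimality, so full support applies.
  · have hU : IsOpen (⋃ j : Fin (n + 1), ⋃ _ : j ≠ i, Metric.closedBall (p j) ε)ᶜ := by
      rw [isOpen_compl_iff]
      exact isClosed_iUnion_of_finite fun j => isClosed_iUnion_of_finite fun _ =>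
        Metric.isClosed_closedBall
    have hne : (⋃ j : Fin (n + 1), ⋃ _ : j ≠ i, Metric.closedBall (p j) ε)ᶜ.Nonempty := by
      rw [Set.nonempty_compl]
      intro h
      have hP : P (s.erase (p i)) := by
        refine Set.eq_univ_of_forall fun y => ?_
        have : y ∈ ⋃ j : Fin (n + 1), ⋃ _ : j ≠ i, Metric.closedBall (p j) ε := by
          rw [h]; trivial
        simp only [Set.mem_iUnion] at this ⊢
        obtain ⟨j, hj, hy⟩ := this
        refine ⟨p j, Finset.mem_erase.2 ⟨fun h => hj ?_, (e.symm j).2⟩, hy⟩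
        exact e.symm.injective (Subtype.ext h)
      have := hs.2 hP (Finset.erase_subset _ _) (e.symm i).2
      simp [p] at this
    have hpos := hU.measure_pos m hne
    refine (ENNReal.toReal_pos hpos.ne' (measure_ne_top _ _)).trans_le
      (measureReal_mono fun y hy => ?_)
    simp only [Set.mem_compl_iff, Set.mem_iUnion, not_exists] at hy
    by_contra hne
    exact hy (a y) hne (ha y)

/-- A measurable function with values in `[c, C]` is the almost everywhere limit of a sequence of
continuous functions with values in `[c, C]`. -/
lemma exists_seq_continuousMap_tendsto_ae {M : Type*} [TopologicalSpace M]
    [TopologicalSpace.PseudoMetrizableSpace M] [MeasurableSpace M] [BorelSpace M]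
    (μ : Measure M) [IsFiniteMeasure μ] {f : M → ℝ} (hf : Measurable f) {c C : ℝ}
    (hfc : ∀ x, f x ∈ Set.Icc c C) :
    ∃ g : ℕ → C(M, ℝ), (∀ n x, g n x ∈ Set.Icc c C) ∧
      ∀ᵐ x ∂μ, Tendsto (fun n => g n x) atTop (𝓝 (f x)) := by
  by_cases hcC : c ≤ C
  swap
  · have : IsEmpty M := ⟨fun x => hcC ((hfc x).1.trans (hfc x).2)⟩
    exact ⟨fun _ => ⟨isEmptyElim, by fun_prop⟩, fun _ => isEmptyElim,
      ae_of_all _ isEmptyElim⟩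
  let := TopologicalSpace.pseudoMetrizableSpacePseudoMetric M
  have hLp : MemLp f 1 μ := MemLp.of_bound hf.aestronglyMeasurable (max |c| |C|) <|
    ae_of_all _ fun x => abs_le_max_abs_abs (hfc x).1 (hfc x).2
  have hex (n : ℕ) := hLp.exists_boundedContinuous_eLpNorm_sub_le ENNReal.one_ne_top
    (ε := ((n : ℝ≥0∞) + 1)⁻¹) (by simp)
  choose g hg hgLp using hex
  have ht : Tendsto (fun n => eLpNorm (⇑(g n) - f) 1 μ) atTop (𝓝 0) := by
    refine tendsto_of_tendsto_of_tendsto_of_le_of_le tendsto_const_nhds ?_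
      (fun _ => zero_le) (fun n => (eLpNorm_sub_comm _ _ _ _).trans_le (hg n))
    exact_mod_cast ENNReal.tendsto_inv_nat_nhds_zero.comp (tendsto_add_atTop_nat 1)
  obtain ⟨ns, -, hns⟩ := (tendstoInMeasure_of_tendsto_eLpNorm one_ne_zero
    (fun n => (hgLp n).1) hLp.1 ht).exists_seq_tendsto_ae
  refine ⟨fun n => ⟨fun x => max c (min C (g (ns n) x)), by fun_prop⟩, fun n x => ?_, ?_⟩
  · exact ⟨le_max_left _ _, max_le hcC (min_le_left _ _)⟩
  · filter_upwards [hns] with x hx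
    have h := (tendsto_const_nhds (x := c)).max ((tendsto_const_nhds (x := C)).min hx)
    rwa [min_eq_right (hfc x).2, max_eq_right (hfc x).1] at h

/-! ### The Dirichlet distribution and its Markov–Krein identity -/

lemma lintegral_fin_prod_eq_prod {n : ℕ} {f : Fin n → ℝ → ℝ≥0∞} (hf : ∀ i, Measurable (f i)) :
    ∫⁻ x : Fin n → ℝ, ∏ i, f i (x i) = ∏ i, ∫⁻ t, f i t := by
  induction n with
  | zero => simp [volume_pi]
  | succ n ih =>
    have hm : Measurable fun x : Fin n → ℝ => ∏ i, f i.succ (x i) :=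
      Finset.measurable_prod _ fun i _ => (hf _).comp (measurable_pi_apply i)
    have h := (volume_preserving_piFinSuccAbove (fun _ : Fin (n + 1) => ℝ) 0).lintegral_comp_emb
      (MeasurableEquiv.measurableEmbedding _) (fun p => f 0 p.1 * ∏ i, f i.succ (p.2 i))
    rw [Fin.prod_univ_succ, ← ih fun i => hf i.succ, ← lintegral_prod_mul (hf 0).aemeasurable
      hm.aemeasurable]
    rw [Measure.volume_eq_prod] at h
    rw [← h]
    simp_rw [Fin.prod_univ_succ]
    rfl

/-- The point of the standard simplex with the given first coordinates. -/
noncomputable def simplexPoint {n : ℕ} (x : Fin n → ℝ) : Fin (n + 1) → ℝ := Fin.snoc x (1 - ∑ i, x i)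

@[simp] lemma simplexPoint_castSucc {n : ℕ} (x : Fin n → ℝ) (i : Fin n) :
    simplexPoint x i.castSucc = x i := by simp [simplexPoint]

@[simp] lemma simplexPoint_last {n : ℕ} (x : Fin n → ℝ) :
    simplexPoint x (Fin.last n) = 1 - ∑ i, x i := by simp [simplexPoint]

@[fun_prop] lemma continuous_simplexPoint {n : ℕ} :
    Continuous (simplexPoint : (Fin n → ℝ) → Fin (n + 1) → ℝ) := by
  refine continuous_pi fun i => ?_
  induction i using Fin.lastCases with
  | last => simp only [simplexPoint_last]; fun_prop
  | cast i => simp only [simplexPoint_castSucc]; fun_prop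

lemma sum_simplexPoint {n : ℕ} (x : Fin n → ℝ) : ∑ i, simplexPoint x i = 1 := by
  simp [Fin.sum_univ_castSucc]

lemma simplexPoint_mem_stdSimplex_iff {n : ℕ} {x : Fin n → ℝ} :
    simplexPoint x ∈ stdSimplex ℝ (Fin (n + 1)) ↔ (∀ i, 0 ≤ x i) ∧ ∑ i, x i ≤ 1 := by
  simp [stdSimplex, sum_simplexPoint, Fin.forall_fin_succ', sub_nonneg]

lemma simplexPoint_eq {n : ℕ} {z : Fin (n + 1) → ℝ} (hz : ∑ i, z i = 1) :
    simplexPoint (fun i => z i.castSucc) = z := by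
  ext i
  rw [Fin.sum_univ_castSucc] at hz
  induction i using Fin.lastCases with
  | last => rw [simplexPoint_last]; linarith
  | cast i => simp

/-- The density of the Dirichlet distribution. -/
noncomputable def dirichletDensity {n : ℕ} (α z : Fin (n + 1) → ℝ) : ℝ :=
  Real.Gamma (∑ i, α i) / (∏ i, Real.Gamma (α i)) * ∏ i, z i ^ (α i - 1)

@[fun_prop] lemma measurable_dirichletDensity {n : ℕ} (α : Fin (n + 1) → ℝ) :
    Measurable (dirichletDensity α) := by
  unfold dirichletDensity
  fun_prop

lemma dirichletDistribution_eq {n : ℕ} (α : Fin (n + 1) → ℝ) :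
    dirichletDistribution α = ((volume.restrict
      (simplexPoint ⁻¹' stdSimplex ℝ (Fin (n + 1)))).withDensity fun x =>
        ENNReal.ofReal (dirichletDensity α (simplexPoint x))).map simplexPoint := by
  have : {x : Fin n → ℝ | (∀ i, 0 ≤ x i) ∧ ∑ i, x i ≤ 1} =
      simplexPoint ⁻¹' stdSimplex ℝ (Fin (n + 1)) := by
    ext x
    exact simplexPoint_mem_stdSimplex_iff.symm
  have hprod (x : Fin n → ℝ) : ∏ i, simplexPoint x i ^ (α i - 1) =
      (∏ i : Fin n, x i ^ (α i.castSucc - 1)) * (1 - ∑ i, x i) ^ (α (Fin.last n) - 1) := by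
    simp [Fin.prod_univ_castSucc]
  simp only [dirichletDistribution, this, dirichletDensity, hprod]
  rfl

lemma measurableSet_preimage_stdSimplex (n : ℕ) :
    MeasurableSet (simplexPoint ⁻¹' stdSimplex ℝ (Fin (n + 1))) :=
  ((isClosed_stdSimplex ℝ _).preimage continuous_simplexPoint).measurableSet

lemma lintegral_dirichletDistribution {n : ℕ} (α : Fin (n + 1) → ℝ)
    {F : (Fin (n + 1) → ℝ) → ℝ≥0∞} (hF : Measurable F) :
    ∫⁻ z, F z ∂dirichletDistribution α =
      ∫⁻ x in simplexPoint ⁻¹' stdSimplex ℝ (Fin (n + 1)),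
        ENNReal.ofReal (dirichletDensity α (simplexPoint x)) * F (simplexPoint x) := by
  have hm : Measurable (simplexPoint : (Fin n → ℝ) → _) := continuous_simplexPoint.measurable
  rw [dirichletDistribution_eq, lintegral_map hF hm,
    lintegral_withDensity_eq_lintegral_mul _ (by fun_prop) (g := fun x => F (simplexPoint x))
      (hF.comp hm)]
  rfl

lemma ae_dirichletDistribution_mem_stdSimplex {n : ℕ} (α : Fin (n + 1) → ℝ) :
    ∀ᵐ z ∂dirichletDistribution α, z ∈ stdSimplex ℝ (Fin (n + 1)) := by
  rw [dirichletDistribution_eq]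
  refine (ae_map_iff continuous_simplexPoint.aemeasurable
    (isClosed_stdSimplex ℝ _).measurableSet).2 ?_
  exact (withDensity_absolutelyContinuous _ _).ae_le
    (ae_restrict_mem (measurableSet_preimage_stdSimplex n))

lemma lintegral_eq_lintegral_comp_smul {n : ℕ} {f : (Fin n → ℝ) → ℝ≥0∞} (hf : Measurable f)
    {t : ℝ} (ht : 0 < t) :
    ∫⁻ y, f y = ∫⁻ x, ENNReal.ofReal (t ^ n) * f (t • x) := by
  have hpos : 0 < t ^ n := pow_pos ht n
  have hvol : (volume : Measure (Fin n → ℝ)) =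
      ENNReal.ofReal (t ^ n) • volume.map (fun x : Fin n → ℝ => t • x) := by
    rw [Measure.map_addHaar_smul _ ht.ne', smul_smul, Module.finrank_fin_fun,
      abs_of_pos (inv_pos.2 hpos), ← ENNReal.ofReal_mul hpos.le, mul_inv_cancel₀ hpos.ne',
      ENNReal.ofReal_one, one_smul]
  have hm : Measurable fun x : Fin n → ℝ => t • x := measurable_const_smul t
  conv_lhs => rw [hvol]
  rw [lintegral_smul_measure, lintegral_map hf hm, smul_eq_mul,
    lintegral_const_mul (f := fun x => f (t • x)) _ (hf.comp hm)]

lemma sum_mul_pos_of_mem_stdSimplex {ι : Type*} [Fintype ι] {l z : ι → ℝ} (hl : ∀ i, 0 < l i)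
    (hz : z ∈ stdSimplex ℝ ι) : 0 < ∑ i, l i * z i := by
  obtain ⟨i, hi⟩ : ∃ i, 0 < z i := by
    by_contra! h
    have := Finset.sum_nonpos fun i (_ : i ∈ Finset.univ) => h i
    linarith [hz.2]
  exact Finset.sum_pos' (fun i _ => mul_nonneg (hl i).le (hz.1 i))
    ⟨i, Finset.mem_univ i, mul_pos (hl i) hi⟩

/-- Independent gamma variables in the coordinates total t and proportions z, with Jacobian t^n. For
fixed z the joint density is, in t, a gamma density with shape ∑ α i and rate ∑ l i * z i, up to a
factor carrying the Dirichlet density. Off the simplex some z i is negative and both sides vanish.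
-/
lemma gammaPDF_mul_scaled {n : ℕ} {α l : Fin (n + 1) → ℝ} (hα : ∀ i, 0 < α i) (hl : ∀ i, 0 < l i)
    (x : Fin n → ℝ) {t : ℝ} (ht : 0 < t) :
    ENNReal.ofReal (t ^ n) * ∏ i, ProbabilityTheory.gammaPDF (α i) (l i) (t * simplexPoint x i) =
      ENNReal.ofReal (∏ i, l i ^ α i) *
        (simplexPoint ⁻¹' stdSimplex ℝ (Fin (n + 1))).indicator (fun x =>
          ENNReal.ofReal (dirichletDensity α (simplexPoint x)) *
            ENNReal.ofReal ((∑ i, l i * simplexPoint x i) ^ (-∑ i, α i))) x *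
        ProbabilityTheory.gammaPDF (∑ i, α i) (∑ i, l i * simplexPoint x i) t := by
  set z := simplexPoint x with hz
  by_cases hx : z ∈ stdSimplex ℝ (Fin (n + 1))
  swap
  · rw [Set.indicator_of_notMem (by exact hx)]
    obtain ⟨i, hi⟩ : ∃ i, z i < 0 := by
      by_contra! h
      exact hx ⟨h, sum_simplexPoint x⟩
    rw [Finset.prod_eq_zero (Finset.mem_univ i), mul_zero, mul_zero, zero_mul]
    exact ProbabilityTheory.gammaPDF_of_neg (mul_neg_of_pos_of_neg ht hi)
  rw [Set.indicator_of_mem (by exact hx)]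
  have hz0 : ∀ i, 0 ≤ z i := hx.1
  have hL : 0 < ∑ i, l i * z i := sum_mul_pos_of_mem_stdSimplex hl hx
  have hβ : 0 < ∑ i, α i := Finset.sum_pos (fun i _ => hα i) Finset.univ_nonempty
  have hΓ : ∀ i, 0 < Real.Gamma (α i) := fun i => Real.Gamma_pos_of_pos (hα i)
  have hΓβ := Real.Gamma_pos_of_pos hβ
  rw [ProbabilityTheory.gammaPDF_of_nonneg ht.le]
  simp only [ProbabilityTheory.gammaPDF_of_nonneg (mul_nonneg ht.le (hz0 _))]
  have hfac : ∀ i, 0 ≤ l i ^ α i / Real.Gamma (α i) * (t * z i) ^ (α i - 1) *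
      Real.exp (-(l i * (t * z i))) := fun i => by
    have := hΓ i
    have := hl i
    have := hz0 i
    positivity
  have hdens : 0 ≤ dirichletDensity α z :=
    mul_nonneg (div_nonneg hΓβ.le (Finset.prod_nonneg fun i _ => (hΓ i).le))
      (Finset.prod_nonneg fun i _ => Real.rpow_nonneg (hz0 i) _)
  have hprod : 0 ≤ ∏ i, l i ^ α i := Finset.prod_nonneg fun i _ => Real.rpow_nonneg (hl i).le _
  rw [← ENNReal.ofReal_prod_of_nonneg fun i _ => hfac i, ← ENNReal.ofReal_mul (by positivity),
    ← ENNReal.ofReal_mul hdens, ← ENNReal.ofReal_mul hprod,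
    ← ENNReal.ofReal_mul (mul_nonneg hprod (mul_nonneg hdens (Real.rpow_nonneg hL.le _)))]
  congr 1
  have hexp : ∏ i, Real.exp (-(l i * (t * z i))) = Real.exp (-((∑ i, l i * z i) * t)) := by
    rw [← Real.exp_sum, Finset.sum_neg_distrib, Finset.sum_mul]
    congr 2
    exact Finset.sum_congr rfl fun i _ => by ring
  have hpow : t ^ n * ∏ i, (t * z i) ^ (α i - 1) =
      t ^ (∑ i, α i - 1) * ∏ i, z i ^ (α i - 1) := by
    simp_rw [fun i => Real.mul_rpow (z := α i - 1) ht.le (hz0 i)]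
    rw [Finset.prod_mul_distrib, ← Real.rpow_sum_of_pos ht, ← mul_assoc, ← Real.rpow_natCast,
      ← Real.rpow_add ht]
    congr 2
    simp
    ring
  rw [Finset.prod_mul_distrib, Finset.prod_mul_distrib, Finset.prod_div_distrib, hexp,
    Real.rpow_neg hL.le, dirichletDensity]
  have hLβ : (∑ i, l i * z i) ^ (∑ i, α i) ≠ 0 := (Real.rpow_pos_of_pos hL _).ne'
  have hΓp : ∏ i, Real.Gamma (α i) ≠ 0 := Finset.prod_ne_zero_iff.2 fun i _ => (hΓ i).ne'
  have e : ∀ a b c d e : ℝ, a * (b * c * d) = (a * c) * (b * d) := by intros; ring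
  rw [e _ _ _ _ 0, hpow]
  field_simp

/-- The Markov–Krein identity for the Dirichlet distribution. -/
lemma lintegral_dirichletDistribution_rpow {n : ℕ} {α l : Fin (n + 1) → ℝ} (hα : ∀ i, 0 < α i)
    (hl : ∀ i, 0 < l i) :
    ∫⁻ z, ENNReal.ofReal ((∑ i, l i * z i) ^ (-∑ i, α i)) ∂dirichletDistribution α =
      ENNReal.ofReal (∏ i, l i ^ (-α i)) := by
  have hβ : 0 < ∑ i, α i := Finset.sum_pos (fun i _ => hα i) Finset.univ_nonempty
  set S := simplexPoint ⁻¹' stdSimplex ℝ (Fin (n + 1))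
  set g : Fin (n + 1) → ℝ → ℝ≥0∞ := fun i => ProbabilityTheory.gammaPDF (α i) (l i) with hg
  have hgm : ∀ i, Measurable (g i) := fun i =>
    (ProbabilityTheory.measurable_gammaPDFReal _ _).ennreal_ofReal
  have hg1 : ∀ i, ∫⁻ t, g i t = 1 := fun i =>
    ProbabilityTheory.lintegral_gammaPDF_eq_one (hα i) (hl i)
  have hgneg : ∀ i t, t < 0 → g i t = 0 := fun i t ht => ProbabilityTheory.gammaPDF_of_neg ht
  set F : (Fin n → ℝ) → ℝ≥0∞ := fun x => ENNReal.ofReal (dirichletDensity α (simplexPoint x)) *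
    ENNReal.ofReal ((∑ i, l i * simplexPoint x i) ^ (-∑ i, α i)) with hF
  have hFm : Measurable F := by fun_prop
  -- The joint density of the first n gamma variables and the total t. Its integral is 1 by
  -- integrating over t first; the scaling y = t x computes it a second time.
  set A : ℝ → (Fin n → ℝ) → ℝ≥0∞ := fun t y =>
    (∏ i : Fin n, g i.castSucc (y i)) * g (Fin.last n) (t - ∑ i, y i) with hA
  have hAm : Measurable (Function.uncurry A) := by
    refine Measurable.mul ?_ ?_
    · exact Finset.measurable_prod _ fun i _ => (hgm _).comp (by fun_prop)
    · exact (hgm _).comp (by fun_prop)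
  have h1 : ∫⁻ t, ∫⁻ y, A t y = 1 := by
    rw [lintegral_lintegral_swap hAm.aemeasurable]
    simp only [hA]
    have (y : Fin n → ℝ) : ∫⁻ t, (∏ i : Fin n, g i.castSucc (y i)) *
        g (Fin.last n) (t - ∑ i, y i) = ∏ i : Fin n, g i.castSucc (y i) := by
      rw [lintegral_const_mul (f := fun t => g (Fin.last n) (t - ∑ i, y i)) _
        ((hgm (Fin.last n)).comp (measurable_id.sub_const _)),
        lintegral_sub_right_eq_self, hg1, mul_one]
    simp_rw [this]
    rw [lintegral_fin_prod_eq_prod fun i => hgm _]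
    simp [hg1]
  have h2 : ∫⁻ t, ∫⁻ y, A t y = ∫⁻ t, ∫⁻ x, ENNReal.ofReal (∏ i, l i ^ α i) *
      S.indicator F x * ProbabilityTheory.gammaPDF (∑ i, α i) (∑ i, l i * simplexPoint x i) t := by
    refine lintegral_congr_ae ?_
    filter_upwards [Measure.ae_ne volume (0 : ℝ)] with t ht0
    rcases lt_or_gt_of_ne ht0 with ht | ht
    · simp only [ProbabilityTheory.gammaPDF_of_neg ht, mul_zero, lintegral_zero]
      refine (lintegral_congr fun y => ?_).trans lintegral_zero
      by_cases hy : ∃ i, y i < 0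
      · obtain ⟨i, hi⟩ := hy
        simp only [hA]
        rw [Finset.prod_eq_zero (Finset.mem_univ i) (hgneg _ _ hi), zero_mul]
      · push Not at hy
        have := Finset.sum_nonneg fun i (_ : i ∈ Finset.univ) => hy i
        simp only [hA]
        rw [hgneg _ _ (by linarith), mul_zero]
    · rw [lintegral_eq_lintegral_comp_smul (f := A t) hAm.of_uncurry_left ht]
      refine lintegral_congr fun x => ?_
      rw [← gammaPDF_mul_scaled hα hl x ht, Fin.prod_univ_castSucc]
      simp [hA, hg, mul_sub, Finset.mul_sum]
  have hS : MeasurableSet S := measurableSet_preimage_stdSimplex n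
  have h3 : ∫⁻ t, ∫⁻ x, ENNReal.ofReal (∏ i, l i ^ α i) * S.indicator F x *
      ProbabilityTheory.gammaPDF (∑ i, α i) (∑ i, l i * simplexPoint x i) t =
      ENNReal.ofReal (∏ i, l i ^ α i) * ∫⁻ x in S, F x := by
    rw [lintegral_lintegral_swap]
    · rw [← lintegral_indicator hS, ← lintegral_const_mul _ (hFm.indicator hS)]
      refine lintegral_congr fun x => ?_
      by_cases hx : x ∈ S
      · have hL : 0 < ∑ i, l i * simplexPoint x i := sum_mul_pos_of_mem_stdSimplex hl hx
        rw [lintegral_const_mul (f := ProbabilityTheory.gammaPDF _ _) _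
          (ProbabilityTheory.measurable_gammaPDFReal _ _).ennreal_ofReal,
          ProbabilityTheory.lintegral_gammaPDF_eq_one hβ hL, mul_one]
      · simp [hx]
    · refine (Measurable.mul ?_ ?_).aemeasurable
      · exact (hFm.indicator hS).const_mul _ |>.comp measurable_snd
      · simp only [ProbabilityTheory.gammaPDF_eq]
        refine (Measurable.ite (measurableSet_Ici.preimage measurable_fst) ?_
          measurable_const).ennreal_ofReal
        fun_prop
  rw [lintegral_dirichletDistribution _ (by fun_prop)]
  have hprod : 0 < ∏ i, l i ^ α i := Finset.prod_pos fun i _ => Real.rpow_pos_of_pos (hl i) _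
  have h4 : ENNReal.ofReal (∏ i, l i ^ α i) * ∫⁻ x in S, F x = 1 := by rw [← h3, ← h2, h1]
  rw [Finset.prod_congr rfl fun i _ => Real.rpow_neg (hl i).le (α i), Finset.prod_inv_distrib,
    ENNReal.ofReal_inv_of_pos hprod]
  exact ENNReal.eq_inv_of_mul_eq_one_left (by rw [mul_comm]; exact h4)

lemma isProbabilityMeasure_dirichletDistribution {n : ℕ} {α : Fin (n + 1) → ℝ}
    (hα : ∀ i, 0 < α i) : IsProbabilityMeasure (dirichletDistribution α) := by
  constructor
  have h := lintegral_dirichletDistribution_rpow (l := fun _ => 1) hα fun _ => one_pos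
  rw [← lintegral_one]
  simp only [one_mul, Real.one_rpow, Finset.prod_const_one, ENNReal.ofReal_one] at h
  refine (lintegral_congr_ae ?_).trans h
  filter_upwards [ae_dirichletDistribution_mem_stdSimplex α] with z hz
  simp [hz.2]

/-! ### Measures on P(M) are determined by their Markov–Krein transform -/

/-- The Laplace transform of the gamma law, the link between powers and exponentials. -/
lemma setIntegral_exp_neg_mul_gammaMeasure {β : ℝ} (hβ : 0 < β) {c : ℝ} (hc : 0 ≤ c) :
    ∫ t in Set.Ioi 0, Real.exp (-(t * c)) ∂ProbabilityTheory.gammaMeasure β 1 =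
      (1 + c) ^ (-β) := by
  have hm : Measurable (ProbabilityTheory.gammaPDF β 1) :=
    (ProbabilityTheory.measurable_gammaPDFReal _ _).ennreal_ofReal
  rw [ProbabilityTheory.gammaMeasure, setIntegral_withDensity_eq_setIntegral_toReal_smul hm
    (ae_of_all _ fun t => ENNReal.ofReal_lt_top) _ measurableSet_Ioi]
  have : ∀ t ∈ Set.Ioi (0 : ℝ), (ProbabilityTheory.gammaPDF β 1 t).toReal •
      Real.exp (-(t * c)) = (Real.Gamma β)⁻¹ * (t ^ (β - 1) * Real.exp (-((1 + c) * t))) := by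
    intro t (ht : 0 < t)
    rw [ProbabilityTheory.gammaPDF, ENNReal.toReal_ofReal
      (ProbabilityTheory.gammaPDFReal_nonneg hβ one_pos t), ProbabilityTheory.gammaPDFReal,
      if_pos ht.le, show -((1 + c) * t) = -(1 * t) + -(t * c) by ring, Real.exp_add, smul_eq_mul,
      Real.one_rpow]
    ring
  rw [setIntegral_congr_fun measurableSet_Ioi this, integral_const_mul,
    Real.integral_rpow_mul_exp_neg_mul_Ioi hβ (by linarith), one_div,
    Real.inv_rpow (by linarith), Real.rpow_neg (by linarith)]
  have := (Real.Gamma_pos_of_pos hβ).ne'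
  field_simp

section

variable {M : Type*} [TopologicalSpace M] [CompactSpace M] [MeasurableSpace M] [BorelSpace M]

/-- The function `(t, ν) ↦ exp (-t ∫ f dν)`. -/
noncomputable def expNegMulIntegral (f : C(M, NNReal)) :
    BoundedContinuousFunction (Set.Ioi (0 : ℝ) × ProbabilityMeasure M) ℝ :=
  BoundedContinuousFunction.ofNormedAddCommGroup
    (fun p => Real.exp (-((p.1 : ℝ) * ∫ x, (f x : ℝ) ∂(p.2 : Measure M))))
    (by
      have := (ProbabilityMeasure.continuous_integral_continuousMap
        (⟨fun x => (f x : ℝ), by fun_prop⟩ : C(M, ℝ))).comp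
        (continuous_snd (X := Set.Ioi (0 : ℝ)))
      simp only [ContinuousMap.coe_mk, Function.comp_def] at this
      fun_prop)
    1 fun p => by
      have : 0 ≤ (p.1 : ℝ) * ∫ x, (f x : ℝ) ∂(p.2 : Measure M) :=
        mul_nonneg (le_of_lt p.1.2) (integral_nonneg fun x => NNReal.coe_nonneg (f x))
      simpa using this

lemma expNegMulIntegral_apply (f : C(M, NNReal)) (p : Set.Ioi (0 : ℝ) × ProbabilityMeasure M) :
    expNegMulIntegral f p = Real.exp (-((p.1 : ℝ) * ∫ x, (f x : ℝ) ∂(p.2 : Measure M))) := rfl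

lemma integrable_continuousMap_coe (f : C(M, NNReal)) (μ : Measure M) [IsFiniteMeasure μ] :
    Integrable (fun x => (f x : ℝ)) μ :=
  (⟨fun x => (f x : ℝ), by fun_prop⟩ : C(M, ℝ)).continuous.integrable_of_hasCompactSupport
    (HasCompactSupport.of_compactSpace _)

variable (M) in
/-- The submonoid of the functions `(t, ν) ↦ exp (-t ∫ f dν)`. -/
noncomputable def expNegMulIntegralSubmonoid :
    Submonoid (BoundedContinuousFunction (Set.Ioi (0 : ℝ) × ProbabilityMeasure M) ℝ) where
  carrier := Set.range expNegMulIntegral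
  one_mem' := ⟨0, by ext p; simp [expNegMulIntegral_apply]⟩
  mul_mem' := by
    rintro _ _ ⟨f, rfl⟩ ⟨g, rfl⟩
    refine ⟨f + g, ?_⟩
    ext p
    simp only [expNegMulIntegral_apply, BoundedContinuousFunction.coe_mul, Pi.mul_apply,
      ContinuousMap.add_apply, NNReal.coe_add]
    rw [integral_add (integrable_continuousMap_coe f _) (integrable_continuousMap_coe g _),
      ← Real.exp_add]
    ring_nf

variable (M) in
/-- The algebra generated by the functions `(t, ν) ↦ exp (-t ∫ f dν)`. -/
noncomputable def expNegMulIntegralAlgebra :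
    StarSubalgebra ℝ (BoundedContinuousFunction (Set.Ioi (0 : ℝ) × ProbabilityMeasure M) ℝ) where
  toSubalgebra := Algebra.adjoin ℝ (expNegMulIntegralSubmonoid M)
  star_mem' {g} hg := by
    have : star g = g := by ext; simp
    rwa [this]

variable [TopologicalSpace.MetrizableSpace M]

/-- The function f = 1 recovers t; dividing by t ≠ 0 then recovers ∫ f dν for all f, hence ν. At t =
0 every generator equals 1, which is why t ranges over `Set.Ioi 0`. -/
lemma separatesPoints_expNegMulIntegralAlgebra :
    ((expNegMulIntegralAlgebra M).map
      (BoundedContinuousFunction.toContinuousMapStarₐ ℝ)).SeparatesPoints := by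
  rintro ⟨t, ν⟩ ⟨t', ν'⟩ hne
  change ProbabilityMeasure M at ν ν'
  by_contra! hcon
  have h (f : C(M, NNReal)) : (t : ℝ) * ∫ x, (f x : ℝ) ∂(ν : Measure M) =
      t' * ∫ x, (f x : ℝ) ∂(ν' : Measure M) := by
    have := hcon (expNegMulIntegral f) ⟨_, ⟨expNegMulIntegral f,
      Algebra.subset_adjoin ⟨f, rfl⟩, rfl⟩, rfl⟩
    simpa [expNegMulIntegral_apply] using this
  have ht : t = t' := Subtype.ext (by simpa using h 1)
  subst ht
  refine hne (Prod.ext rfl (ProbabilityMeasure.toMeasure_injective ?_))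
  refine ext_of_forall_lintegral_eq_of_IsFiniteMeasure
    (μ := (ν : Measure M)) (ν := (ν' : Measure M)) fun f => ?_
  have := mul_left_cancel₀ (ne_of_gt t.2) (h f.toContinuousMap)
  have hf (ρ : ProbabilityMeasure M) : ∫⁻ x, f x ∂(ρ : Measure M) =
      ENNReal.ofReal (∫ x, (f x : ℝ) ∂(ρ : Measure M)) := by
    rw [ofReal_integral_eq_lintegral_ofReal (f := fun x => (f x : ℝ))
      (integrable_continuousMap_coe f.toContinuousMap _)
      (ae_of_all _ fun x => NNReal.coe_nonneg (f x))]
    simp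
  exact (hf ν).trans ((congrArg _ this).trans (hf ν').symm)

/-- A finite measure on the space of probability measures is determined by the integrals of
`ν ↦ (∫ f dν) ^ (-β)`, for `f` continuous and positive. -/
lemma measure_probabilityMeasure_ext_of_integral_rpow {Q Q' : Measure (ProbabilityMeasure M)}
    [IsFiniteMeasure Q] [IsFiniteMeasure Q'] {β : ℝ} (hβ : 0 < β)
    (h : ∀ f : C(M, ℝ), (∀ x, 0 < f x) →
      ∫ ν : ProbabilityMeasure M, (∫ x, f x ∂(ν : Measure M)) ^ (-β) ∂Q =
        ∫ ν : ProbabilityMeasure M, (∫ x, f x ∂(ν : Measure M)) ^ (-β) ∂Q') : Q = Q' := by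
  have : IsProbabilityMeasure (ProbabilityTheory.gammaMeasure β 1) :=
    ProbabilityTheory.isProbabilityMeasure_gammaMeasure hβ one_pos
  let γ : Measure (Set.Ioi (0 : ℝ)) := (ProbabilityTheory.gammaMeasure β 1).comap (↑)
  have hγ : γ Set.univ ≠ 0 := by
    intro h0
    have h1 := setIntegral_exp_neg_mul_gammaMeasure hβ le_rfl
    rw [← integral_subtype_comap measurableSet_Ioi] at h1
    rw [show (ProbabilityTheory.gammaMeasure β 1).comap ((↑) : Set.Ioi (0 : ℝ) → ℝ) = 0 from
      Measure.measure_univ_eq_zero.1 h0] at h1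
    simp at h1
  have : IsFiniteMeasure γ := ⟨by
    rw [comap_subtype_coe_apply measurableSet_Ioi]
    exact measure_lt_top _ _⟩
  have hpol : PolishSpace (Set.Ioi (0 : ℝ)) := isOpen_Ioi.polishSpace
  have key (P : Measure (ProbabilityMeasure M)) [IsFiniteMeasure P] (f : C(M, NNReal)) :
      ∫ p, expNegMulIntegral f p ∂(γ.prod P) =
        ∫ ν : ProbabilityMeasure M, (∫ x, (1 + (f x : ℝ)) ∂(ν : Measure M)) ^ (-β) ∂P := by
    rw [integral_prod_symm _ ((expNegMulIntegral f).integrable _)]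
    refine integral_congr_ae (ae_of_all _ fun ν => ?_)
    simp only [expNegMulIntegral_apply]
    rw [integral_subtype_comap measurableSet_Ioi
      (fun t : ℝ => Real.exp (-(t * ∫ x, (f x : ℝ) ∂(ν : Measure M)))),
      setIntegral_exp_neg_mul_gammaMeasure hβ (integral_nonneg fun x => NNReal.coe_nonneg (f x)),
      integral_add (integrable_const _) (integrable_continuousMap_coe f _)]
    simp
  -- By Stone–Weierstrass it is enough to compare integrals over the algebra, which is the linear
  -- span of the exponentials; there `key` reduces to the hypothesis for 1 + f.
  have hprod : γ.prod Q = γ.prod Q' := by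
    refine ext_of_forall_mem_subalgebra_integral_eq_of_polish (𝕜 := ℝ)
      separatesPoints_expNegMulIntegralAlgebra fun g hg => ?_
    have hg' : g ∈ Submodule.span ℝ (expNegMulIntegralSubmonoid M : Set
        (BoundedContinuousFunction (Set.Ioi (0 : ℝ) × ProbabilityMeasure M) ℝ)) := by
      have : g ∈ Subalgebra.toSubmodule
        (Algebra.adjoin ℝ (expNegMulIntegralSubmonoid M : Set _)) := hg
      rwa [Algebra.adjoin_eq_span, Submonoid.closure_eq] at this
    clear hg
    induction hg' using Submodule.span_induction with
    | mem g hg =>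
      obtain ⟨f, rfl⟩ := hg
      rw [key, key]
      exact h (⟨fun x => 1 + (f x : ℝ), by fun_prop⟩ : C(M, ℝ)) fun x => by
        have := (f x).2
        simp only [ContinuousMap.coe_mk]
        positivity
    | zero => simp
    | add g g' _ _ hg hg' =>
      simp only [BoundedContinuousFunction.coe_add, Pi.add_apply]
      rw [integral_add (g.integrable _) (g'.integrable _),
        integral_add (g.integrable _) (g'.integrable _), hg, hg']
    | smul c g _ hg =>
      simp only [BoundedContinuousFunction.coe_smul]
      rw [integral_smul, integral_smul, hg]
  ext s hs
  have := congrArg (fun P => P (Set.univ ×ˢ s)) hprod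
  simp only [Measure.prod_prod] at this
  exact (ENNReal.mul_right_inj hγ (measure_ne_top _ _)).1 this

end

/-! ### Step functions, discrete measures and limits in the identity -/

lemma integral_comp_eq_sum {M ι : Type*} [MeasurableSpace M] [Fintype ι] [MeasurableSpace ι]
    [MeasurableSingletonClass ι] (ν : Measure M) [IsFiniteMeasure ν] {a : M → ι}
    (ha : Measurable a) (l : ι → ℝ) :
    ∫ x, l (a x) ∂ν = ∑ i, l i * ν.real (a ⁻¹' {i}) := by
  have : IsFiniteMeasure (ν.map a) := Measure.isFiniteMeasure_map _ _
  rw [← integral_map (f := l) ha.aemeasurable (measurable_of_finite l).aestronglyMeasurable,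
    integral_fintype (.of_finite)]
  refine Finset.sum_congr rfl fun i _ => ?_
  rw [map_measureReal_apply ha (measurableSet_singleton i), smul_eq_mul, mul_comm]

lemma exp_neg_mul_integral_log_comp {M ι : Type*} [MeasurableSpace M] [Fintype ι]
    [MeasurableSpace ι] [MeasurableSingletonClass ι] (m : Measure M) [IsFiniteMeasure m]
    {a : M → ι} (ha : Measurable a) {l : ι → ℝ} (hl : ∀ i, 0 < l i) (β : ℝ) :
    Real.exp (-β * ∫ x, Real.log (l (a x)) ∂m) =
      ∏ i, l i ^ (-(β * m.real (a ⁻¹' {i}))) := by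
  rw [integral_comp_eq_sum m ha fun i => Real.log (l i), Finset.mul_sum, Real.exp_sum]
  refine Finset.prod_congr rfl fun i _ => ?_
  rw [Real.rpow_def_of_pos (hl i)]
  ring_nf

lemma sum_measureReal_fiber {M ι : Type*} [MeasurableSpace M] [Fintype ι]
    [MeasurableSpace ι] [MeasurableSingletonClass ι] (m : Measure M) [IsProbabilityMeasure m]
    {a : M → ι} (ha : Measurable a) : ∑ i, m.real (a ⁻¹' {i}) = 1 := by
  simpa using (integral_comp_eq_sum m ha fun _ => 1).symm

lemma integral_dirichletDistribution_rpow {n : ℕ} {α l : Fin (n + 1) → ℝ} (hα : ∀ i, 0 < α i)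
    (hl : ∀ i, 0 < l i) :
    ∫ z, (∑ i, l i * z i) ^ (-∑ i, α i) ∂dirichletDistribution α = ∏ i, l i ^ (-α i) := by
  rw [integral_eq_lintegral_of_nonneg_ae, lintegral_dirichletDistribution_rpow hα hl,
    ENNReal.toReal_ofReal (Finset.prod_nonneg fun i _ => Real.rpow_nonneg (hl i).le _)]
  · filter_upwards [ae_dirichletDistribution_mem_stdSimplex α] with z hz
    exact Real.rpow_nonneg (sum_mul_pos_of_mem_stdSimplex hl hz).le _
  · exact Measurable.aestronglyMeasurable (by fun_prop)

/-- A retraction of the space of vectors onto the standard simplex. -/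
noncomputable def simplexRetraction {n : ℕ} (z : Fin (n + 1) → ℝ) : Fin (n + 1) → ℝ :=
  open Classical in if z ∈ stdSimplex ℝ (Fin (n + 1)) then z else Pi.single 0 1

lemma simplexRetraction_mem {n : ℕ} (z : Fin (n + 1) → ℝ) :
    simplexRetraction z ∈ stdSimplex ℝ (Fin (n + 1)) := by
  unfold simplexRetraction
  split_ifs with h
  · exact h
  · exact single_mem_stdSimplex ℝ 0

lemma simplexRetraction_of_mem {n : ℕ} {z : Fin (n + 1) → ℝ}
    (hz : z ∈ stdSimplex ℝ (Fin (n + 1))) : simplexRetraction z = z := if_pos hz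

@[fun_prop] lemma measurable_simplexRetraction {n : ℕ} :
    Measurable (simplexRetraction : (Fin (n + 1) → ℝ) → _) :=
  Measurable.ite (isClosed_stdSimplex ℝ _).measurableSet measurable_id measurable_const

/-- The probability measure with weights `z` at the points `p`. -/
noncomputable def simplexMeasure {M : Type*} [MeasurableSpace M] {n : ℕ} (p : Fin (n + 1) → M)
    (z : Fin (n + 1) → ℝ) : ProbabilityMeasure M :=
  ⟨∑ i, ENNReal.ofReal (simplexRetraction z i) • Measure.dirac (p i), ⟨by
    have h := simplexRetraction_mem z
    simp only [Measure.coe_finsetSum, Finset.sum_apply, Measure.smul_apply, measure_univ,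
      smul_eq_mul, mul_one]
    rw [← ENNReal.ofReal_sum_of_nonneg fun i _ => h.1 i, h.2, ENNReal.ofReal_one]⟩⟩

lemma toMeasure_simplexMeasure {M : Type*} [MeasurableSpace M] {n : ℕ} (p : Fin (n + 1) → M)
    (z : Fin (n + 1) → ℝ) : (simplexMeasure p z : Measure M) =
      ∑ i, ENNReal.ofReal (simplexRetraction z i) • Measure.dirac (p i) := rfl

@[fun_prop] lemma measurable_simplexMeasure {M : Type*} [MeasurableSpace M] {n : ℕ}
    (p : Fin (n + 1) → M) : Measurable (simplexMeasure p) := by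
  refine Measurable.subtype_mk (Measure.measurable_of_measurable_coe _ fun s hs => ?_)
  simp only [Measure.coe_finsetSum, Finset.sum_apply, Measure.smul_apply, smul_eq_mul]
  fun_prop

lemma integral_simplexMeasure {M : Type*} [MeasurableSpace M] [MeasurableSingletonClass M] {n : ℕ}
    (p : Fin (n + 1) → M) {z : Fin (n + 1) → ℝ} (hz : z ∈ stdSimplex ℝ (Fin (n + 1))) (f : M → ℝ) :
    ∫ x, f x ∂(simplexMeasure p z : Measure M) = ∑ i, f (p i) * z i := by
  rw [toMeasure_simplexMeasure, integral_finsetSum_measure fun i _ =>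
    (integrable_dirac (by simp)).smul_measure ENNReal.ofReal_ne_top]
  refine Finset.sum_congr rfl fun i _ => ?_
  rw [integral_smul_measure, integral_dirac, simplexRetraction_of_mem hz,
    ENNReal.toReal_ofReal (hz.1 i), smul_eq_mul, mul_comm]

lemma measurable_integral_probabilityMeasure {M : Type*} [MeasurableSpace M] {g : M → ℝ}
    (hg : Measurable g) (hg0 : ∀ x, 0 ≤ g x) :
    Measurable fun ν : ProbabilityMeasure M => ∫ x, g x ∂(ν : Measure M) := by
  simp_rw [fun ν : ProbabilityMeasure M => integral_eq_lintegral_of_nonneg_ae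
    (μ := (ν : Measure M)) (ae_of_all _ hg0) hg.aestronglyMeasurable]
  exact ((Measure.measurable_lintegral hg.ennreal_ofReal).comp measurable_subtype_coe).ennreal_toReal

lemma integral_mem_Icc {M : Type*} [MeasurableSpace M] (ν : Measure M) [IsProbabilityMeasure ν]
    {g : M → ℝ} (hg : Measurable g) {c C : ℝ} (hc : ∀ x, g x ∈ Set.Icc c C) :
    Integrable g ν ∧ ∫ x, g x ∂ν ∈ Set.Icc c C := by
  have hi : Integrable g ν := Integrable.of_mem_Icc c C hg.aemeasurable (ae_of_all _ hc)
  refine ⟨hi, ?_, ?_⟩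
  · simpa using integral_mono (integrable_const c) hi fun x => (hc x).1
  · simpa using integral_mono hi (integrable_const C) fun x => (hc x).2

lemma abs_log_le_of_mem_Icc {c C x : ℝ} (hc : 0 < c) (hx : x ∈ Set.Icc c C) :
    |Real.log x| ≤ max |Real.log c| |Real.log C| :=
  abs_le_max_abs_abs (Real.log_le_log hc hx.1) (Real.log_le_log (hc.trans_le hx.1) hx.2)

/-- The Markov–Krein identity for `Q` and the function `f` passes to bounded limits. -/
lemma integral_rpow_eq_exp_of_tendsto {M : Type*} [MeasurableSpace M] {m : Measure M}
    [IsProbabilityMeasure m] {Q : Measure (ProbabilityMeasure M)} [IsFiniteMeasure Q] {β : ℝ}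
    (hβ : 0 < β) {g : ℕ → M → ℝ} {f : M → ℝ} (hg : ∀ k, Measurable (g k)) {c C : ℝ} (hc : 0 < c)
    (hgc : ∀ k x, g k x ∈ Set.Icc c C) (hfc : ∀ x, 0 < f x)
    (hm : ∀ᵐ x ∂m, Tendsto (fun k => g k x) atTop (𝓝 (f x)))
    (hQ : ∀ᵐ ν : ProbabilityMeasure M ∂Q, ∀ᵐ x ∂(ν : Measure M),
      Tendsto (fun k => g k x) atTop (𝓝 (f x)))
    (hMK : ∀ k, ∫ ν : ProbabilityMeasure M, (∫ x, g k x ∂(ν : Measure M)) ^ (-β) ∂Q =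
      Real.exp (-β * ∫ x, Real.log (g k x) ∂m)) :
    ∫ ν : ProbabilityMeasure M, (∫ x, f x ∂(ν : Measure M)) ^ (-β) ∂Q =
      Real.exp (-β * ∫ x, Real.log (f x) ∂m) := by
  have h1 : Tendsto (fun k => ∫ ν : ProbabilityMeasure M,
      (∫ x, g k x ∂(ν : Measure M)) ^ (-β) ∂Q) atTop
      (𝓝 (∫ ν : ProbabilityMeasure M, (∫ x, f x ∂(ν : Measure M)) ^ (-β) ∂Q)) := by
    refine tendsto_integral_of_dominated_convergence (fun _ => c ^ (-β)) (fun k => ?_)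
      (integrable_const _) (fun k => ae_of_all _ fun ν => ?_) ?_
    · exact ((measurable_integral_probabilityMeasure (hg k) fun x => hc.le.trans (hgc k x).1).pow_const
        _).aestronglyMeasurable
    · have h := (integral_mem_Icc (ν : Measure M) (hg k) (hgc k)).2
      rw [Real.norm_of_nonneg (Real.rpow_nonneg (hc.le.trans h.1) _)]
      exact Real.rpow_le_rpow_of_nonpos hc h.1 (neg_nonpos.2 hβ.le)
    · filter_upwards [hQ] with ν hν
      have hlim : Tendsto (fun k => ∫ x, g k x ∂(ν : Measure M)) atTop
          (𝓝 (∫ x, f x ∂(ν : Measure M))) := by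
        refine tendsto_integral_of_dominated_convergence (fun _ => max |c| |C|)
          (fun k => (hg k).aestronglyMeasurable) (integrable_const _)
          (fun k => ae_of_all _ fun x => abs_le_max_abs_abs (hgc k x).1 (hgc k x).2) hν
      have hpos : c ≤ ∫ x, f x ∂(ν : Measure M) :=
        ge_of_tendsto' hlim fun k => (integral_mem_Icc (ν : Measure M) (hg k) (hgc k)).2.1
      exact hlim.rpow_const (.inl (hc.trans_le hpos).ne')
  have h2 : Tendsto (fun k => Real.exp (-β * ∫ x, Real.log (g k x) ∂m)) atTop
      (𝓝 (Real.exp (-β * ∫ x, Real.log (f x) ∂m))) := by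
    refine (Real.continuous_exp.tendsto _).comp (Tendsto.const_mul _ ?_)
    refine tendsto_integral_of_dominated_convergence (fun _ => max |Real.log c| |Real.log C|)
      (fun k => (hg k).log.aestronglyMeasurable) (integrable_const _)
      (fun k => ae_of_all _ fun x => abs_log_le_of_mem_Icc hc (hgc k x)) ?_
    filter_upwards [hm] with x hx
    exact hx.log (hfc x).ne'
  simp_rw [hMK] at h1
  exact tendsto_nhds_unique h1 h2

/-- The Markov–Krein identity for continuous positive functions. -/
def SatisfiesMarkovKrein {M : Type*} [TopologicalSpace M] [MeasurableSpace M] (m : Measure M)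
    (β : ℝ) (Q : Measure (ProbabilityMeasure M)) : Prop :=
  ∀ f : C(M, ℝ), (∀ x, 0 < f x) →
    ∫ ν : ProbabilityMeasure M, (∫ x, f x ∂(ν : Measure M)) ^ (-β) ∂Q =
      Real.exp (-β * ∫ x, Real.log (f x) ∂m)

lemma SatisfiesMarkovKrein.isProbabilityMeasure {M : Type*} [TopologicalSpace M]
    [MeasurableSpace M] {m : Measure M} {β : ℝ} {Q : Measure (ProbabilityMeasure M)}
    (h : SatisfiesMarkovKrein m β Q) : IsProbabilityMeasure Q := by
  have h1 := h 1 fun _ => one_pos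
  simp only [ContinuousMap.one_apply, integral_const, probReal_univ, smul_eq_mul, mul_one,
    Real.one_rpow, Real.log_one, mul_zero, Real.exp_zero] at h1
  exact ⟨by rwa [measureReal_def, ENNReal.toReal_eq_one_iff] at h1⟩

lemma exists_forall_mem_Icc_of_pos {M : Type*} [TopologicalSpace M] [CompactSpace M] (f : C(M, ℝ))
    (hf : ∀ x, 0 < f x) : ∃ c C : ℝ, 0 < c ∧ ∀ x, f x ∈ Set.Icc c C := by
  cases isEmpty_or_nonempty M
  · exact ⟨1, 1, one_pos, isEmptyElim⟩
  obtain ⟨x, -, hx⟩ := isCompact_univ.exists_isMinOn Set.univ_nonempty f.continuous.continuousOn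
  obtain ⟨y, -, hy⟩ := isCompact_univ.exists_isMaxOn Set.univ_nonempty f.continuous.continuousOn
  exact ⟨f x, f y, hf x, fun z => ⟨hx (Set.mem_univ z), hy (Set.mem_univ z)⟩⟩

/-! ### From the partition laws to the Markov–Krein identity -/

section

variable {M : Type*} [MeasurableSpace M] {m : Measure M} {β : ℝ}
  {Q : Measure (ProbabilityMeasure M)}

lemma measurable_measureReal_partition {n : ℕ} {A : Fin (n + 1) → Set M}
    (hA : ∀ i, MeasurableSet (A i)) :
    Measurable fun (ν : ProbabilityMeasure M) (i : Fin (n + 1)) => (ν : Measure M).real (A i) :=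
  measurable_pi_lambda _ fun i =>
    ((Measure.measurable_coe (hA i)).comp measurable_subtype_coe).ennreal_toReal

lemma IsDirichletFerguson.map_fiber (h : IsDirichletFerguson m β Q) {n : ℕ} {a : M → Fin (n + 1)}
    (ha : Measurable a) (hpos : ∀ i, 0 < m.real (a ⁻¹' {i})) :
    Q.map (fun (ν : ProbabilityMeasure M) (i : Fin (n + 1)) =>
      (ν : Measure M).real (a ⁻¹' {i})) = dirichletDistribution fun i => β * m.real (a ⁻¹' {i}) :=
  h.map_partition n _ (fun i => ha (measurableSet_singleton i))
    (fun i j hij => Disjoint.preimage _ (by simpa using hij))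
    (by rw [← Set.preimage_iUnion, Set.iUnion_of_singleton, Set.preimage_univ]) hpos

lemma IsDirichletFerguson.isProbabilityMeasure [IsProbabilityMeasure m] (h : IsDirichletFerguson m β Q) (hβ : 0 < β) :
    IsProbabilityMeasure Q := by
  -- The partition into a single cell already forces total mass 1.
  have hpos (i : Fin 1) : 0 < m.real ((fun _ => 0) ⁻¹' {i}) := by
    simp [Fin.fin_one_eq_zero i]
  have hD := isProbabilityMeasure_dirichletDistribution (n := 0)
    (α := fun i => β * m.real ((fun _ => 0) ⁻¹' {i})) fun i => mul_pos hβ (hpos i)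
  rw [← h.map_fiber (n := 0) (a := fun _ => 0) measurable_const hpos] at hD
  exact Measure.isProbabilityMeasure_of_map fun (ν : ProbabilityMeasure M) (i : Fin 1) =>
    (ν : Measure M).real ((fun _ => (0 : Fin 1)) ⁻¹' {i})

lemma integral_dirichletDistribution_fiber [IsProbabilityMeasure m] (hβ : 0 < β) {n : ℕ} {a : M → Fin (n + 1)}
    (ha : Measurable a) (hpos : ∀ i, 0 < m.real (a ⁻¹' {i})) {l : Fin (n + 1) → ℝ}
    (hl : ∀ i, 0 < l i) :
    ∫ z, (∑ i, l i * z i) ^ (-β) ∂dirichletDistribution (fun i => β * m.real (a ⁻¹' {i})) =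
      Real.exp (-β * ∫ x, Real.log (l (a x)) ∂m) := by
  have := integral_dirichletDistribution_rpow (α := fun i => β * m.real (a ⁻¹' {i}))
    (fun i => mul_pos hβ (hpos i)) hl
  rw [exp_neg_mul_integral_log_comp m ha hl, ← this, ← Finset.mul_sum, sum_measureReal_fiber m ha,
    mul_one]

lemma IsDirichletFerguson.integral_rpow_comp [IsProbabilityMeasure m] (h : IsDirichletFerguson m β Q) (hβ : 0 < β) {n : ℕ}
    {a : M → Fin (n + 1)} (ha : Measurable a) (hpos : ∀ i, 0 < m.real (a ⁻¹' {i}))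
    {l : Fin (n + 1) → ℝ} (hl : ∀ i, 0 < l i) :
    ∫ ν : ProbabilityMeasure M, (∫ x, l (a x) ∂(ν : Measure M)) ^ (-β) ∂Q =
      Real.exp (-β * ∫ x, Real.log (l (a x)) ∂m) := by
  rw [← integral_dirichletDistribution_fiber hβ ha hpos hl, ← h.map_fiber ha hpos,
    integral_map (measurable_measureReal_partition fun i =>
      ha (measurableSet_singleton i)).aemeasurable
      (Measurable.aestronglyMeasurable (by fun_prop))]
  simp_rw [fun ν : ProbabilityMeasure M => integral_comp_eq_sum (ν : Measure M) ha l]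

end

/-! ### Uniqueness, and existence by compactness -/

section

variable {M : Type*} [MetricSpace M] [CompactSpace M] [MeasurableSpace M] [BorelSpace M]
  {m : Measure M} [IsProbabilityMeasure m] [m.IsOpenPosMeasure] {β : ℝ}

variable (m) in
lemma exists_seq_measurable_index : ∃ (n : ℕ → ℕ) (a : ∀ k, M → Fin (n k + 1))
    (p : ∀ k, Fin (n k + 1) → M), (∀ k, Measurable (a k)) ∧
      (∀ x, Tendsto (fun k => p k (a k x)) atTop (𝓝 x)) ∧
      ∀ k i, 0 < m.real (a k ⁻¹' {i}) := by
  have : Nonempty M := nonempty_of_isProbabilityMeasure m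
  choose n a p ha hp hpos using fun k : ℕ => exists_measurable_index m
    (Nat.one_div_pos_of_nat (α := ℝ) (n := k))
  refine ⟨n, a, p, ha, fun x => ?_, hpos⟩
  rw [tendsto_iff_dist_tendsto_zero]
  refine squeeze_zero (fun _ => dist_nonneg) (fun k => ?_) tendsto_one_div_add_atTop_nhds_zero_nat
  rw [dist_comm]
  exact hp k x

/-- The step functions obtained by sampling f at one point per cell satisfy the identity and
converge to f as the partitions are refined. -/
lemma IsDirichletFerguson.satisfiesMarkovKrein {Q : Measure (ProbabilityMeasure M)}
    (h : IsDirichletFerguson m β Q) (hβ : 0 < β) : SatisfiesMarkovKrein m β Q := by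
  intro f hf
  have := h.isProbabilityMeasure hβ
  obtain ⟨n, a, p, ha, hp, hpos⟩ := exists_seq_measurable_index m
  obtain ⟨c, C, hc, hfc⟩ := exists_forall_mem_Icc_of_pos f hf
  have hlim (x : M) : Tendsto (fun k => f (p k (a k x))) atTop (𝓝 (f x)) :=
    (f.continuous.tendsto x).comp (hp x)
  refine integral_rpow_eq_exp_of_tendsto hβ (g := fun k x => f (p k (a k x))) (fun k => ?_) hc
    (fun k x => hfc _) hf (ae_of_all _ hlim) (ae_of_all _ fun ν => ae_of_all _ hlim) fun k => ?_
  · exact (measurable_of_finite fun i => f (p k i)).comp (ha k)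
  · exact h.integral_rpow_comp hβ (ha k) (hpos k) (l := fun i => f (p k i)) fun i => hf _

lemma IsDirichletFerguson.eq {Q Q' : Measure (ProbabilityMeasure M)}
    (h : IsDirichletFerguson m β Q) (h' : IsDirichletFerguson m β Q') (hβ : 0 < β) : Q = Q' := by
  have := h.isProbabilityMeasure hβ
  have := h'.isProbabilityMeasure hβ
  exact measure_probabilityMeasure_ext_of_integral_rpow hβ fun f hf =>
    (h.satisfiesMarkovKrein hβ f hf).trans (h'.satisfiesMarkovKrein hβ f hf).symm

/-- Placing a Dirichlet vector at the sample points gives a random measure satisfying the identity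
for f sampled on the partition. A weak limit point of these laws satisfies it for f, because ν ↦ (∫
f dν)^(-β) is continuous. No consistency argument is needed. -/
lemma exists_satisfiesMarkovKrein (hβ : 0 < β) : ∃ Q : ProbabilityMeasure (ProbabilityMeasure M),
    SatisfiesMarkovKrein m β (Q : Measure (ProbabilityMeasure M)) := by
  obtain ⟨n, a, p, ha, hp, hpos⟩ := exists_seq_measurable_index m
  have hD (k : ℕ) := isProbabilityMeasure_dirichletDistribution
    (α := fun i => β * m.real (a k ⁻¹' {i})) fun i => mul_pos hβ (hpos k i)
  let R : ℕ → ProbabilityMeasure (ProbabilityMeasure M) := fun k =>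
    ⟨(dirichletDistribution fun i => β * m.real (a k ⁻¹' {i})).map (simplexMeasure (p k)),
      Measure.isProbabilityMeasure_map (measurable_simplexMeasure _).aemeasurable⟩
  obtain ⟨Q, φ, hφ, hQ⟩ := CompactSpace.tendsto_subseq R
  refine ⟨Q, fun f hf => ?_⟩
  obtain ⟨c, C, hc, hfc⟩ := exists_forall_mem_Icc_of_pos f hf
  have hcont : Continuous fun ν : ProbabilityMeasure M => (∫ x, f x ∂(ν : Measure M)) ^ (-β) :=
    (ProbabilityMeasure.continuous_integral_continuousMap f).rpow_const fun ν =>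
      .inl (hc.trans_le (integral_mem_Icc (ν : Measure M) f.continuous.measurable hfc).2.1).ne'
  have h1 := ((ProbabilityMeasure.continuous_integral_continuousMap
    (⟨_, hcont⟩ : C(ProbabilityMeasure M, ℝ))).tendsto Q).comp hQ
  have h2 (k : ℕ) : ∫ ν : ProbabilityMeasure M, (∫ x, f x ∂(ν : Measure M)) ^ (-β) ∂(R k :
      Measure (ProbabilityMeasure M)) = Real.exp (-β * ∫ x, Real.log (f (p k (a k x))) ∂m) := by
    rw [← integral_dirichletDistribution_fiber hβ (ha k) (hpos k) (l := fun i => f (p k i))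
      fun i => hf _]
    change ∫ ν : ProbabilityMeasure M, _ ∂Measure.map _ _ = _
    rw [integral_map (measurable_simplexMeasure _).aemeasurable
      hcont.measurable.aestronglyMeasurable]
    refine integral_congr_ae ?_
    filter_upwards [ae_dirichletDistribution_mem_stdSimplex _] with z hz
    rw [integral_simplexMeasure _ hz]
  have h3 : Tendsto (fun k => Real.exp (-β * ∫ x, Real.log (f (p k (a k x))) ∂m)) atTop
      (𝓝 (Real.exp (-β * ∫ x, Real.log (f x) ∂m))) := by
    refine (Real.continuous_exp.tendsto _).comp (Tendsto.const_mul _ ?_)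
    refine tendsto_integral_of_dominated_convergence (fun _ => max |Real.log c| |Real.log C|)
      (fun k => ?_) (integrable_const _)
      (fun k => ae_of_all _ fun x => abs_log_le_of_mem_Icc hc (hfc _)) (ae_of_all _ fun x => ?_)
    · exact ((measurable_of_finite fun i => Real.log (f (p k i))).comp (ha k)).aestronglyMeasurable
    · exact ((f.continuous.tendsto x).comp (hp x)).log (hf x).ne'
  refine tendsto_nhds_unique h1 ((h3.comp hφ.tendsto_atTop).congr fun k => ?_)
  exact (h2 (φ k)).symm

end

/-! ### From the Markov–Krein identity back to the partition laws -/

section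

variable {M : Type*} [MetricSpace M] [MeasurableSpace M] [BorelSpace M] {m : Measure M}
  [IsProbabilityMeasure m] {β : ℝ}

lemma SatisfiesMarkovKrein.integral_rpow {Q : Measure (ProbabilityMeasure M)} [IsFiniteMeasure Q]
    (h : SatisfiesMarkovKrein m β Q) (hβ : 0 < β) {f : M → ℝ} (hf : Measurable f) {c C : ℝ}
    (hc : 0 < c) (hfc : ∀ x, f x ∈ Set.Icc c C) :
    ∫ ν : ProbabilityMeasure M, (∫ x, f x ∂(ν : Measure M)) ^ (-β) ∂Q =
      Real.exp (-β * ∫ x, Real.log (f x) ∂m) := by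
  have hcoe : Measurable fun ν : ProbabilityMeasure M => (ν : Measure M) := measurable_subtype_coe
  -- The mean measure of Q: convergence μ-a.e. implies convergence ν-a.e. for Q-a.e. ν.
  -- Approximating with respect to m + μ therefore serves both sides of the identity.
  let μ : Measure M := Q.bind fun ν => (ν : Measure M)
  have : IsFiniteMeasure μ := ⟨by
    rw [Measure.bind_apply MeasurableSet.univ hcoe.aemeasurable]
    simp⟩
  obtain ⟨g, hg, hlim⟩ := exists_seq_continuousMap_tendsto_ae (m + μ) hf hfc
  rw [ae_add_measure_iff] at hlim
  refine integral_rpow_eq_exp_of_tendsto hβ (g := fun k => g k)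
    (fun k => (g k).continuous.measurable) hc hg (fun x => hc.trans_le (hfc x).1) hlim.1
    (Measure.ae_ae_of_ae_bind hcoe.aemeasurable hlim.2) fun k => ?_
  exact h (g k) fun x => hc.trans_le (hg k x).1

/-- For f = 1 + 1_A the identity reads ∫ (1 + ν(A))^(-β) dQ = 1, while the integrand is at most 1
and strictly smaller when ν(A) > 0. -/
lemma SatisfiesMarkovKrein.ae_null {Q : Measure (ProbabilityMeasure M)}
    (h : SatisfiesMarkovKrein m β Q) (hβ : 0 < β) {A : Set M} (hA : MeasurableSet A)
    (hmA : m A = 0) : ∀ᵐ ν : ProbabilityMeasure M ∂Q, (ν : Measure M) A = 0 := by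
  have := h.isProbabilityMeasure
  have hfm : Measurable (1 + A.indicator fun _ => (1 : ℝ)) :=
    measurable_one.add (measurable_const.indicator hA)
  have h1 := h.integral_rpow hβ (f := 1 + A.indicator fun _ => (1 : ℝ)) hfm (c := 1) (C := 2)
    one_pos fun x => by
      by_cases hx : x ∈ A <;> norm_num [hx]
  have h2 : ∫ x, Real.log ((1 + A.indicator fun _ => (1 : ℝ)) x) ∂m = 0 := by
    refine integral_eq_zero_of_ae ?_
    filter_upwards [measure_eq_zero_iff_ae_notMem.1 hmA] with x hx
    simp [hx]
  have h3 (ν : ProbabilityMeasure M) :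
      ∫ x, (1 + A.indicator fun _ => (1 : ℝ)) x ∂(ν : Measure M) = 1 + (ν : Measure M).real A := by
    simp only [Pi.add_apply, Pi.one_apply]
    rw [integral_add (integrable_const _) ((integrable_const _).indicator hA),
      integral_indicator_const _ hA]
    simp
  simp_rw [h3, h2, mul_zero, Real.exp_zero] at h1
  have hreal : Measurable fun ν : ProbabilityMeasure M => (ν : Measure M).real A :=
    ((Measure.measurable_coe hA).comp measurable_subtype_coe).ennreal_toReal
  have hle (ν : ProbabilityMeasure M) : (1 + (ν : Measure M).real A) ^ (-β) ≤ 1 :=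
    Real.rpow_le_one_of_one_le_of_nonpos (by linarith [measureReal_nonneg (μ := (ν : Measure M)) (s := A)])
      (neg_nonpos.2 hβ.le)
  have hnn (ν : ProbabilityMeasure M) : 0 ≤ (1 + (ν : Measure M).real A) ^ (-β) :=
    Real.rpow_nonneg (by positivity) _
  have hint : Integrable (fun ν : ProbabilityMeasure M => (1 + (ν : Measure M).real A) ^ (-β)) Q :=
    Integrable.of_mem_Icc 0 1 ((hreal.const_add 1).pow_const _).aemeasurable
      (ae_of_all _ fun ν => ⟨hnn ν, hle ν⟩)
  have h4 : ∫ ν : ProbabilityMeasure M, (1 - (1 + (ν : Measure M).real A) ^ (-β)) ∂Q = 0 := by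
    rw [integral_sub (integrable_const _) hint, h1]
    simp
  rw [integral_eq_zero_iff_of_nonneg (fun ν => sub_nonneg.2 (hle ν))
    ((integrable_const _).sub hint)] at h4
  filter_upwards [h4] with ν hν
  by_contra hne
  have hpos : 0 < (ν : Measure M).real A := ENNReal.toReal_pos hne (measure_ne_top _ _)
  have := Real.rpow_lt_one_of_one_lt_of_neg (x := 1 + (ν : Measure M).real A) (z := -β)
    (by linarith) (by linarith)
  simp only [Pi.zero_apply] at hν
  linarith

/-- Pushing ν forward along a, both random measures on the finite index space have the same
Markov–Krein transform, so the uniqueness statement on that space applies. -/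
lemma SatisfiesMarkovKrein.map_fiber {Q : Measure (ProbabilityMeasure M)}
    (h : SatisfiesMarkovKrein m β Q) (hβ : 0 < β) {n : ℕ} {a : M → Fin (n + 1)}
    (ha : Measurable a) (hpos : ∀ i, 0 < m.real (a ⁻¹' {i})) :
    Q.map (fun (ν : ProbabilityMeasure M) (i : Fin (n + 1)) =>
      (ν : Measure M).real (a ⁻¹' {i})) = dirichletDistribution fun i => β * m.real (a ⁻¹' {i}) := by
  have := h.isProbabilityMeasure
  set D := dirichletDistribution fun i => β * m.real (a ⁻¹' {i}) with hD
  have : IsProbabilityMeasure D := isProbabilityMeasure_dirichletDistribution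
    fun i => mul_pos hβ (hpos i)
  let W : ProbabilityMeasure M → ProbabilityMeasure (Fin (n + 1)) := fun ν => ν.map ha.aemeasurable
  have hW : Measurable W :=
    ((Measure.measurable_map a ha).comp measurable_subtype_coe).subtype_mk
  have hsm : Measurable (simplexMeasure (id : Fin (n + 1) → Fin (n + 1))) :=
    measurable_simplexMeasure _
  have hpush : Q.map W = D.map (simplexMeasure id) := by
    have : IsProbabilityMeasure (Q.map W) := Measure.isProbabilityMeasure_map hW.aemeasurable
    have : IsProbabilityMeasure (D.map (simplexMeasure id)) :=
      Measure.isProbabilityMeasure_map hsm.aemeasurable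
    refine measure_probabilityMeasure_ext_of_integral_rpow hβ fun f hf => ?_
    obtain ⟨c, C, hc, hfc⟩ := exists_forall_mem_Icc_of_pos f hf
    have hm : Measurable fun ρ : ProbabilityMeasure (Fin (n + 1)) =>
        (∫ x, f x ∂(ρ : Measure (Fin (n + 1)))) ^ (-β) :=
      (measurable_integral_probabilityMeasure f.continuous.measurable fun x =>
        (hf x).le).pow_const _
    rw [integral_map hW.aemeasurable hm.aestronglyMeasurable,
      integral_map hsm.aemeasurable hm.aestronglyMeasurable]
    have h1 : ∫ z, (∫ x, f x ∂(simplexMeasure id z : Measure (Fin (n + 1)))) ^ (-β) ∂D =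
        ∫ z, (∑ i, f i * z i) ^ (-β) ∂D := by
      refine integral_congr_ae ?_
      filter_upwards [ae_dirichletDistribution_mem_stdSimplex _] with z hz
      rw [integral_simplexMeasure _ hz]
      rfl
    rw [h1, integral_dirichletDistribution_fiber hβ ha hpos hf,
      ← h.integral_rpow hβ (f := fun x => f (a x)) (f.continuous.measurable.comp ha) hc fun x => hfc (a x)]
    refine integral_congr_ae (ae_of_all _ fun ν => ?_)
    simp only [W, ProbabilityMeasure.toMeasure_map]
    rw [integral_map ha.aemeasurable f.continuous.aestronglyMeasurable]
  have hev : Measurable fun (ρ : ProbabilityMeasure (Fin (n + 1))) (i : Fin (n + 1)) =>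
      (ρ : Measure (Fin (n + 1))).real {i} :=
    measurable_measureReal_partition fun i => measurableSet_singleton i
  have h2 := congrArg (Measure.map fun (ρ : ProbabilityMeasure (Fin (n + 1))) (i : Fin (n + 1)) =>
      (ρ : Measure (Fin (n + 1))).real {i}) hpush
  rw [Measure.map_map hev hW, Measure.map_map hev hsm] at h2
  -- On the simplex, reading off the masses of singletons inverts `simplexMeasure id`.
  have h3 : ((fun (ρ : ProbabilityMeasure (Fin (n + 1))) (i : Fin (n + 1)) =>
      (ρ : Measure (Fin (n + 1))).real {i}) ∘ simplexMeasure id) =ᵐ[D] id := by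
    filter_upwards [ae_dirichletDistribution_mem_stdSimplex _] with z hz
    ext i
    have := integral_simplexMeasure id hz (Set.indicator {i} 1)
    rw [integral_indicator_one (measurableSet_singleton i)] at this
    simpa [Set.indicator_apply] using this
  rw [Measure.map_congr h3, Measure.map_id] at h2
  rw [← h2]
  congr 1
  ext ν i
  simp only [Function.comp_apply, W, ProbabilityMeasure.toMeasure_map]
  rw [map_measureReal_apply ha (measurableSet_singleton i)]

lemma SatisfiesMarkovKrein.isDirichletFerguson {Q : Measure (ProbabilityMeasure M)}
    (h : SatisfiesMarkovKrein m β Q) (hβ : 0 < β) : IsDirichletFerguson m β Q where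
  map_partition n A hA hdisj hcov hpos := by
    have hex (x : M) : ∃ i, x ∈ A i := by
      have : x ∈ ⋃ i, A i := by rw [hcov]; trivial
      simpa using this
    choose a hax using hex
    have hfib (i : Fin (n + 1)) : a ⁻¹' {i} = A i := by
      ext x
      refine ⟨fun hx => ?_, fun hx => ?_⟩
      · rw [← show a x = i from hx]
        exact hax x
      · by_contra hne
        exact Set.disjoint_left.1 (hdisj hne) (hax x) hx
    have ha : Measurable a := measurable_to_countable' fun i => by rw [hfib]; exact hA i
    have := h.map_fiber hβ ha fun i => by rw [hfib]; exact hpos i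
    simpa only [hfib] using this
  ae_null A hA hmA := h.ae_null hβ hA hmA

end

/-- Existence and uniqueness of the Dirichlet–Ferguson measure. -/
theorem existsUnique_isDirichletFerguson {M : Type*} [MetricSpace M] [CompactSpace M]
    [MeasurableSpace M] [BorelSpace M] (m : Measure M) [IsProbabilityMeasure m]
    [m.IsOpenPosMeasure] {β : ℝ} (hβ : 0 < β) :
    ∃! Q : ProbabilityMeasure (ProbabilityMeasure M),
      IsDirichletFerguson m β (Q : Measure (ProbabilityMeasure M)) := by
  obtain ⟨Q, hQ⟩ := exists_satisfiesMarkovKrein (m := m) hβ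
  exact ⟨Q, hQ.isDirichletFerguson hβ, fun Q' hQ' => ProbabilityMeasure.toMeasure_injective
    (hQ'.eq (hQ.isDirichletFerguson hβ) hβ)⟩

/-! ### Variational formula for the relative entropy -/

section Duality

open InformationTheory

variable {M : Type*} [MeasurableSpace M] {m ν : Measure M} [IsProbabilityMeasure m]
  [IsProbabilityMeasure ν]

lemma integrable_log_of_mem_Icc (ν : Measure M) [IsFiniteMeasure ν] {f : M → ℝ} (hf : Measurable f) {c C : ℝ}
    (hc : 0 < c) (hfc : ∀ x, f x ∈ Set.Icc c C) : Integrable (fun x => Real.log (f x)) ν :=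
  Integrable.of_bound hf.log.aestronglyMeasurable _
    (ae_of_all _ fun x => abs_log_le_of_mem_Icc hc (hfc x))

/-- The easy half of the variational formula for the relative entropy. -/
lemma integral_log_sub_log_integral_le_klDiv {f : M → ℝ} (hf : Measurable f) {c C : ℝ}
    (hc : 0 < c) (hfc : ∀ x, f x ∈ Set.Icc c C) :
    ((∫ x, Real.log (f x) ∂m - Real.log (∫ x, f x ∂ν) : ℝ) : EReal) ≤ (klDiv m ν : EReal) := by
  by_cases h : klDiv m ν = ∞
  · simp [h]
  obtain ⟨hac, hint⟩ := klDiv_ne_top_iff.1 h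
  have hexp (x : M) : Real.exp (Real.log (f x)) = f x := Real.exp_log (hc.trans_le (hfc x).1)
  have hfi : Integrable (fun x => Real.exp (Real.log (f x))) ν := by
    simpa only [hexp] using (integral_mem_Icc ν hf hfc).1
  have hlog := integrable_log_of_mem_Icc m hf hc hfc
  -- The entropy of m relative to the normalised measure f ν is the entropy relative to ν minus the
  -- left-hand side, and it is nonnegative.
  have h1 := integral_llr_tilted_right hac hlog hfi hint
  have hp : IsProbabilityMeasure (ν.tilted fun x => Real.log (f x)) :=
    isProbabilityMeasure_tilted hfi
  have h2 := integral_llr_add_sub_measure_univ_nonneg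
    (hac.trans (absolutelyContinuous_tilted hfi)) (integrable_llr_tilted_right hac hlog hint hfi)
  simp only [probReal_univ, add_sub_cancel_right, hexp] at h1 h2
  have h3 := toReal_klDiv_of_measure_eq hac (by simp)
  rw [← EReal.coe_toReal (x := (klDiv m ν : EReal)) (by simpa using h) (by simp),
    EReal.coe_le_coe_iff, EReal.toReal_coe_ennreal, h3]
  linarith

lemma klFun_eq_mul_log_sub (r : ℝ) : klFun r = r * Real.log r - r + 1 := by
  rw [klFun]
  ring

/-- Clamping moves r towards 1 without crossing it, so (r - f) log f ≥ 0 for the clamped value f;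
what remains is `klFun` at f. The nonnegativity is what Fatou's lemma needs below. -/
lemma mul_log_clamp_sub_add_one_nonneg {r c C : ℝ} (hc : 0 < c) (hc1 : c ≤ 1) (hC1 : 1 ≤ C) :
    0 ≤ r * Real.log (max c (min C r)) - max c (min C r) + 1 := by
  set f := max c (min C r) with hf
  have hf0 : 0 < f := hc.trans_le (le_max_left _ _)
  have hkl : 0 ≤ f * Real.log f - f + 1 := by
    have := klFun_nonneg hf0.le
    rwa [klFun_eq_mul_log_sub] at this
  suffices f * Real.log f ≤ r * Real.log f by linarith
  rcases le_total 1 f with h1 | h1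
  · have : f ≤ max c r := max_le_max le_rfl (min_le_right _ _)
    rcases le_total c r with h | h
    · rw [max_eq_right h] at this
      exact mul_le_mul_of_nonneg_right this (Real.log_nonneg h1)
    · rw [max_eq_left h] at this
      have : f = 1 := le_antisymm (this.trans hc1) h1
      simp [this]
  · rcases le_total C r with h | h
    · have : C ≤ f := by rw [hf, min_eq_left h]; exact le_max_right _ _
      have : f = 1 := le_antisymm h1 (hC1.trans this)
      simp [this]
    · refine mul_le_mul_of_nonpos_right ?_ (Real.log_nonpos hf0.le h1)
      rw [hf, min_eq_right h]; exact le_max_right _ _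

/-- The hard half of the variational formula for the relative entropy, with bounded measurable
functions. -/
lemma exists_measurable_lt_of_lt_klDiv {a : ℝ} (ha : (a : EReal) < (klDiv m ν : EReal)) :
    ∃ (f : M → ℝ) (c C : ℝ), Measurable f ∧ 0 < c ∧ (∀ x, f x ∈ Set.Icc c C) ∧
      a < ∫ x, Real.log (f x) ∂m - Real.log (∫ x, f x ∂ν) := by
  rcases lt_or_ge a 0 with ha0 | ha0
  · exact ⟨1, 1, 1, measurable_one, one_pos, fun _ => by simp, by simpa using ha0⟩
  by_cases hac : m ≪ ν
  swap
  · obtain ⟨A, hA, hνA, hmA⟩ : ∃ A, MeasurableSet A ∧ ν A = 0 ∧ m A ≠ 0 := by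
      by_contra! h
      exact hac (Measure.AbsolutelyContinuous.mk h)
    have hpos : 0 < m.real A := ENNReal.toReal_pos hmA (measure_ne_top _ _)
    -- With f = exp K on the ν-null set A and 1 elsewhere, the functional equals K m(A) = a + 1.
    set K := (a + 1) / m.real A
    have hK : 0 ≤ K := by positivity
    refine ⟨fun x => Real.exp (A.indicator (fun _ => K) x), 1, Real.exp K,
      (measurable_const.indicator hA).exp, one_pos, fun x => ?_, ?_⟩
    · by_cases hx : x ∈ A <;> simp [hx, hK]
    · simp only [Real.log_exp]
      have h1 : ∫ x, Real.exp (A.indicator (fun _ => K) x) ∂ν = 1 := by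
        rw [integral_congr_ae (g := fun _ => 1)]
        · simp
        · filter_upwards [measure_eq_zero_iff_ae_notMem.1 hνA] with x hx
          simp [hx]
      rw [h1, integral_indicator_const _ hA, smul_eq_mul, mul_div_cancel₀ _ hpos.ne', Real.log_one]
      linarith
  · set ρ : M → ℝ := fun x => (m.rnDeriv ν x).toReal with hρ
    have hρm : Measurable ρ := (Measure.measurable_rnDeriv _ _).ennreal_toReal
    have hρ0 (x : M) : 0 ≤ ρ x := ENNReal.toReal_nonneg
    -- The optimal f is the density ρ itself; clamping makes it bounded and bounded away from 0.
    set f : ℕ → M → ℝ := fun n x => max ((n : ℝ) + 1)⁻¹ (min ((n : ℝ) + 1) (ρ x)) with hf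
    have hinv1 (n : ℕ) : ((n : ℝ) + 1)⁻¹ ≤ 1 := inv_le_one_of_one_le₀ (by simp)
    have hfm (n : ℕ) : Measurable (f n) := by fun_prop
    have hc (n : ℕ) : 0 < ((n : ℝ) + 1)⁻¹ := by positivity
    have hfc (n : ℕ) (x : M) : f n x ∈ Set.Icc ((n : ℝ) + 1)⁻¹ ((n : ℝ) + 1) :=
      ⟨le_max_left _ _, max_le ((hinv1 n).trans (by simp)) (min_le_left _ _)⟩
    set h : ℕ → M → ℝ := fun n x => ρ x * Real.log (f n x) - f n x + 1 with hh
    have hhm (n : ℕ) : Measurable (h n) := by fun_prop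
    have hh0 (n : ℕ) (x : M) : 0 ≤ h n x :=
      mul_log_clamp_sub_add_one_nonneg (hc n) (hinv1 n) (by simp)
    have hlim (x : M) : Tendsto (fun n => h n x) atTop (𝓝 (klFun (ρ x))) := by
      rw [klFun_eq_mul_log_sub]
      have hinv : Tendsto (fun n : ℕ => ((n : ℝ) + 1)⁻¹) atTop (𝓝 0) := by
        simpa using tendsto_one_div_add_atTop_nhds_zero_nat (𝕜 := ℝ)
      have hev : ∀ᶠ n : ℕ in atTop, min ((n : ℝ) + 1) (ρ x) = ρ x := by
        obtain ⟨N, hN⟩ := exists_nat_ge (ρ x)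
        filter_upwards [eventually_ge_atTop N] with n hn
        have : (N : ℝ) ≤ n := by exact_mod_cast hn
        exact min_eq_right (by linarith)
      have hft : Tendsto (fun n => f n x) atTop (𝓝 (ρ x)) := by
        have : Tendsto (fun n : ℕ => max ((n : ℝ) + 1)⁻¹ (ρ x)) atTop (𝓝 (max 0 (ρ x))) :=
          hinv.max tendsto_const_nhds
        rw [max_eq_right (hρ0 x)] at this
        refine this.congr' ?_
        filter_upwards [hev] with n hn
        simp only [hf, hn]
      refine (Tendsto.sub ?_ hft).add_const 1
      -- Where ρ = 0 the logarithm diverges, but the product vanishes for every n.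
      rcases (hρ0 x).eq_or_lt with h0 | h0
      · simp [← h0]
      · exact (hft.log h0.ne').const_mul _
    have hfatou : klDiv m ν ≤ liminf (fun n => ∫⁻ x, ENNReal.ofReal (h n x) ∂ν) atTop := by
      rw [klDiv_eq_lintegral_klFun_of_ac hac]
      refine le_trans (lintegral_mono fun x => ?_)
        (lintegral_liminf_le fun n => (hhm n).ennreal_ofReal)
      exact ((ENNReal.continuous_ofReal.tendsto _).comp (hlim x)).liminf_eq.ge
    have ha' : ENNReal.ofReal a < klDiv m ν := by
      rw [← EReal.coe_ennreal_lt_coe_ennreal_iff, EReal.coe_ennreal_ofReal, max_eq_left ha0]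
      exact ha
    obtain ⟨n, hn⟩ := (eventually_lt_of_lt_liminf (ha'.trans_le hfatou)).exists
    have hlogi := integrable_log_of_mem_Icc m (hfm n) (hc n) (hfc n)
    have hfi := (integral_mem_Icc ν (hfm n) (hfc n)).1
    have hρi : Integrable (fun x => ρ x * Real.log (f n x)) ν :=
      (integrable_rnDeriv_smul_iff hac).2 hlogi
    have hhi : Integrable (h n) ν := (hρi.sub hfi).add (integrable_const 1)
    rw [← ofReal_integral_eq_lintegral_ofReal hhi (ae_of_all _ (hh0 n)),
      ENNReal.ofReal_lt_ofReal_iff_of_nonneg ha0] at hn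
    have h1 : ∫ x, h n x ∂ν = ∫ x, Real.log (f n x) ∂m - ∫ x, f n x ∂ν + 1 := by
      simp only [hh]
      rw [integral_add (f := fun x => ρ x * Real.log (f n x) - f n x) (hρi.sub hfi)
        (integrable_const 1), integral_sub hρi hfi]
      have := integral_rnDeriv_smul hac (f := fun x => Real.log (f n x))
      simp only [smul_eq_mul] at this
      simp [hρ, this]
    refine ⟨f n, _, _, hfm n, hc n, hfc n, ?_⟩
    -- The bound log y ≤ y - 1 at y = ∫ f dν replaces the linear term by the logarithm.
    have := Real.log_le_sub_one_of_pos ((hc n).trans_le (integral_mem_Icc ν (hfm n) (hfc n)).2.1)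
    linarith

/-- The hard half of the variational formula for the relative entropy, with continuous
functions. -/
lemma exists_continuousMap_lt_of_lt_klDiv [TopologicalSpace M]
    [TopologicalSpace.PseudoMetrizableSpace M] [BorelSpace M] {a : ℝ}
    (ha : (a : EReal) < (klDiv m ν : EReal)) :
    ∃ (f : C(M, ℝ)) (c C : ℝ), 0 < c ∧ (∀ x, f x ∈ Set.Icc c C) ∧
      a < ∫ x, Real.log (f x) ∂m - Real.log (∫ x, f x ∂ν) := by
  obtain ⟨f, c, C, hf, hc, hfc, hlt⟩ := exists_measurable_lt_of_lt_klDiv ha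
  obtain ⟨g, hg, hlim⟩ := exists_seq_continuousMap_tendsto_ae (m + ν) hf hfc
  rw [ae_add_measure_iff] at hlim
  have h1 : Tendsto (fun k => ∫ x, Real.log (g k x) ∂m) atTop (𝓝 (∫ x, Real.log (f x) ∂m)) := by
    refine tendsto_integral_of_dominated_convergence (fun _ => max |Real.log c| |Real.log C|)
      (fun k => (g k).continuous.measurable.log.aestronglyMeasurable) (integrable_const _)
      (fun k => ae_of_all _ fun x => abs_log_le_of_mem_Icc hc (hg k x)) ?_
    filter_upwards [hlim.1] with x hx
    exact hx.log (hc.trans_le (hfc x).1).ne'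
  have h2 : Tendsto (fun k => ∫ x, g k x ∂ν) atTop (𝓝 (∫ x, f x ∂ν)) :=
    tendsto_integral_of_dominated_convergence (fun _ => max |c| |C|)
      (fun k => (g k).continuous.measurable.aestronglyMeasurable) (integrable_const _)
      (fun k => ae_of_all _ fun x => abs_le_max_abs_abs (hg k x).1 (hg k x).2) hlim.2
  have h3 := h1.sub (h2.log (hc.trans_le (integral_mem_Icc ν hf hfc).2.1).ne')
  obtain ⟨k, hk⟩ := (h3.eventually_const_lt hlt).exists
  exact ⟨g k, c, C, hc, hg k, hk⟩

end Duality

/-! ### Lower semicontinuity and the upper bound -/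

section UpperBound

open InformationTheory

variable {M : Type*} [MetricSpace M] [CompactSpace M] [MeasurableSpace M] [BorelSpace M]
  {m : Measure M}

lemma continuous_log_integral {f : C(M, ℝ)} {c C : ℝ} (hc : 0 < c)
    (hfc : ∀ x, f x ∈ Set.Icc c C) :
    Continuous fun ν : ProbabilityMeasure M => Real.log (∫ x, f x ∂(ν : Measure M)) :=
  (ProbabilityMeasure.continuous_integral_continuousMap f).log fun ν =>
    (hc.trans_le (integral_mem_Icc (ν : Measure M) f.continuous.measurable hfc).2.1).ne'

variable (m) in
-- The entropy is a supremum of functionals continuous in ν.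
lemma lowerSemicontinuous_klDiv [IsProbabilityMeasure m] :
    LowerSemicontinuous fun ν : ProbabilityMeasure M => klDiv m (ν : Measure M) := by
  intro ν y hy
  have hy' : ((y.toReal : ℝ) : EReal) < (klDiv m (ν : Measure M) : EReal) := by
    rw [EReal.coe_ennreal_toReal hy.ne_top]
    exact_mod_cast hy
  obtain ⟨f, c, C, hc, hfc, hlt⟩ := exists_continuousMap_lt_of_lt_klDiv hy'
  have hcont := (continuous_const (y := ∫ x, Real.log (f x) ∂m)).sub (continuous_log_integral hc hfc)
  filter_upwards [(hcont.tendsto ν).eventually_const_lt hlt] with ν' hν'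
  have h := (EReal.coe_lt_coe_iff.2 hν').trans_le
    (integral_log_sub_log_integral_le_klDiv f.continuous.measurable hc hfc)
  rw [EReal.coe_ennreal_toReal hy.ne_top] at h
  exact_mod_cast h

/-- The exponential Markov inequality for the Dirichlet–Ferguson measure. -/
lemma SatisfiesMarkovKrein.measure_lt_le {β : ℝ} {Q : Measure (ProbabilityMeasure M)}
    (h : SatisfiesMarkovKrein m β Q) (hβ : 0 < β) {f : C(M, ℝ)} {c C : ℝ} (hc : 0 < c)
    (hfc : ∀ x, f x ∈ Set.Icc c C) (a : ℝ) :
    Q {ν | a < ∫ x, Real.log (f x) ∂m - Real.log (∫ x, f x ∂(ν : Measure M))} ≤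
      ENNReal.ofReal (Real.exp (-(β * a))) := by
  have := h.isProbabilityMeasure
  set L := ∫ x, Real.log (f x) ∂m
  have hpos (ν : ProbabilityMeasure M) : c ≤ ∫ x, f x ∂(ν : Measure M) :=
    (integral_mem_Icc (ν : Measure M) f.continuous.measurable hfc).2.1
  have hcont : Continuous fun ν : ProbabilityMeasure M => (∫ x, f x ∂(ν : Measure M)) ^ (-β) :=
    (ProbabilityMeasure.continuous_integral_continuousMap f).rpow_const fun ν =>
      .inl (hc.trans_le (hpos ν)).ne'
  have hint : Integrable (fun ν : ProbabilityMeasure M => (∫ x, f x ∂(ν : Measure M)) ^ (-β)) Q :=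
    hcont.integrable_of_hasCompactSupport (HasCompactSupport.of_compactSpace _)
  -- The event forces (∫ f dν)^(-β) ≥ exp (β (a - L)), and the mean of this power is exp (-β L).
  have h1 := mul_meas_ge_le_integral_of_nonneg (μ := Q)
    (ae_of_all _ fun ν => Real.rpow_nonneg (hc.le.trans (hpos ν)) (-β)) hint
    (Real.exp (β * (a - L)))
  rw [h f fun x => hc.trans_le (hfc x).1] at h1
  have h2 : Q.real {ν | a < L - Real.log (∫ x, f x ∂(ν : Measure M))} ≤
      Q.real {ν | Real.exp (β * (a - L)) ≤ (∫ x, f x ∂(ν : Measure M)) ^ (-β)} := by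
    refine measureReal_mono fun ν (hν : a < _) => ?_
    change Real.exp (β * (a - L)) ≤ (∫ x, f x ∂(ν : Measure M)) ^ (-β)
    rw [Real.rpow_def_of_pos (hc.trans_le (hpos ν)), Real.exp_le_exp]
    nlinarith
  rw [← ofReal_measureReal]
  refine ENNReal.ofReal_le_ofReal (h2.trans ?_)
  rw [show -(β * a) = -β * L - β * (a - L) by ring, Real.exp_sub, le_div_iff₀ (Real.exp_pos _),
    mul_comm]
  exact h1

/-- N will be the size of a finite cover; N + 1 keeps the logarithm finite when the cover is empty.
-/
lemma log_ofReal_exp_mul (N : ℕ) {β : ℝ} (hβ : 0 < β) (a : ℝ) :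
    ((1 / β : ℝ) : EReal) * ENNReal.log (ENNReal.ofReal ((N + 1 : ℝ) * Real.exp (-(β * a)))) =
      ((Real.log (N + 1) / β - a : ℝ) : EReal) := by
  have hN : (0 : ℝ) < N + 1 := by positivity
  rw [ENNReal.log_ofReal_of_pos (by positivity), Real.log_mul hN.ne' (Real.exp_pos _).ne',
    Real.log_exp, ← EReal.coe_mul]
  congr 1
  field_simp
  ring

/-- For a below the infimum, each ν in F has an open neighbourhood of mass at most exp (-βa).
Compactness leaves finitely many, and their number disappears after division by β. -/
lemma limsup_log_measure_le [IsProbabilityMeasure m] {Q : ℝ → Measure (ProbabilityMeasure M)}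
    (hQ : ∀ β : ℝ, 0 < β → SatisfiesMarkovKrein m β (Q β)) {F : Set (ProbabilityMeasure M)}
    (hF : IsClosed F) :
    limsup (fun β : ℝ => ((1 / β : ℝ) : EReal) * ENNReal.log (Q β F)) atTop ≤
      -(⨅ ν ∈ F, (klDiv m (ν : Measure M) : EReal)) := by
  rw [EReal.le_neg]
  refine EReal.ge_of_forall_gt_iff_ge.1 fun a ha => ?_
  rw [EReal.le_neg, ← EReal.coe_neg]
  have hex (ν : ProbabilityMeasure M) (hν : ν ∈ F) : ∃ (f : C(M, ℝ)) (c C : ℝ), 0 < c ∧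
      (∀ x, f x ∈ Set.Icc c C) ∧
      a < ∫ x, Real.log (f x) ∂m - Real.log (∫ x, f x ∂(ν : Measure M)) :=
    exists_continuousMap_lt_of_lt_klDiv (ha.trans_le (iInf₂_le ν hν))
  choose! f c C hc hfc hlt using hex
  let U : ProbabilityMeasure M → Set (ProbabilityMeasure M) := fun ν =>
    {ν' | a < ∫ x, Real.log (f ν x) ∂m - Real.log (∫ x, f ν x ∂(ν' : Measure M))}
  obtain ⟨t, htF, ht⟩ := hF.isCompact.elim_nhds_subcover U fun ν hν =>
    (isOpen_lt continuous_const (continuous_const.sub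
      (continuous_log_integral (hc ν hν) (hfc ν hν)))).mem_nhds (hlt ν hν)
  have hbound (β : ℝ) (hβ : 0 < β) :
      Q β F ≤ ENNReal.ofReal ((t.card + 1 : ℝ) * Real.exp (-(β * a))) :=
    calc Q β F ≤ Q β (⋃ ν ∈ t, U ν) := measure_mono ht
      _ ≤ ∑ ν ∈ t, Q β (U ν) := measure_biUnion_finset_le _ _
      _ ≤ ∑ ν ∈ t, ENNReal.ofReal (Real.exp (-(β * a))) := Finset.sum_le_sum fun ν hν =>
        (hQ β hβ).measure_lt_le hβ (hc ν (htF ν hν)) (hfc ν (htF ν hν)) a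
      _ = ENNReal.ofReal (t.card * Real.exp (-(β * a))) := by
        rw [Finset.sum_const, nsmul_eq_mul, ENNReal.ofReal_mul (by positivity),
          ENNReal.ofReal_natCast]
      _ ≤ _ := by gcongr; linarith
  have hlim : Tendsto (fun β : ℝ => ((Real.log (t.card + 1) / β - a : ℝ) : EReal)) atTop
      (𝓝 ((-a : ℝ) : EReal)) := by
    refine (continuous_coe_real_ereal.tendsto _).comp ?_
    simpa using (tendsto_id.const_div_atTop (Real.log (t.card + 1))).sub_const a
  rw [← hlim.limsup_eq]
  refine limsup_le_limsup ?_
  filter_upwards [eventually_gt_atTop 0] with β hβ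
  rw [← log_ofReal_exp_mul _ hβ]
  have h0 : (0 : EReal) ≤ ((1 / β : ℝ) : EReal) := by exact_mod_cast (one_div_pos.2 hβ).le
  exact mul_le_mul_of_nonneg_left (ENNReal.log_monotone (hbound β hβ)) h0

end UpperBound

/-! ### Lower bounds for Dirichlet distributions with large parameters -/

section DirichletLowerBound

variable {n : ℕ} {p : Fin (n + 1) → ℝ}

lemma dirichletDensity_nonneg {α z : Fin (n + 1) → ℝ} (hα : ∀ i, 0 < α i) (hz : ∀ i, 0 ≤ z i) :
    0 ≤ dirichletDensity α z :=
  mul_nonneg (div_nonneg (Real.Gamma_nonneg_of_nonneg (Finset.sum_nonneg fun i _ => (hα i).le))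
      (Finset.prod_nonneg fun i _ => Real.Gamma_nonneg_of_nonneg (hα i).le))
    (Finset.prod_nonneg fun i _ => Real.rpow_nonneg (hz i) _)

lemma dirichletDensity_pos {α z : Fin (n + 1) → ℝ} (hα : ∀ i, 0 < α i) (hz : ∀ i, 0 < z i) :
    0 < dirichletDensity α z :=
  mul_pos (div_pos (Real.Gamma_pos_of_pos (Finset.sum_pos (fun i _ => hα i) Finset.univ_nonempty))
      (Finset.prod_pos fun i _ => Real.Gamma_pos_of_pos (hα i)))
    (Finset.prod_pos fun i _ => Real.rpow_pos_of_pos (hz i) _)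

/-- The normalizing constant of the Dirichlet distribution. -/
noncomputable def dirichletConst (α : Fin (n + 1) → ℝ) : ℝ :=
  Real.Gamma (∑ i, α i) / (∏ i, Real.Gamma (α i))

lemma dirichletConst_pos {α : Fin (n + 1) → ℝ} (hα : ∀ i, 0 < α i) : 0 < dirichletConst α :=
  div_pos (Real.Gamma_pos_of_pos (Finset.sum_pos (fun i _ => hα i) Finset.univ_nonempty))
    (Finset.prod_pos fun i _ => Real.Gamma_pos_of_pos (hα i))

/-- The exponents split as β p - 1 = (β - 1) p + (p - 1), so β enters only through an exponential
tilt and a constant. -/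
lemma dirichletDensity_smul (hp : ∀ i, 0 < p i) {z : Fin (n + 1) → ℝ} (hz : ∀ i, 0 < z i)
    (β : ℝ) : dirichletDensity (fun i => β * p i) z =
      dirichletConst (fun i => β * p i) / dirichletConst p *
        Real.exp ((β - 1) * ∑ i, p i * Real.log (z i)) * dirichletDensity p z := by
  have h1 : ∏ i, z i ^ (β * p i - 1) =
      Real.exp ((β - 1) * ∑ i, p i * Real.log (z i)) * ∏ i, z i ^ (p i - 1) := by
    rw [Finset.mul_sum, Real.exp_sum, ← Finset.prod_mul_distrib]
    refine Finset.prod_congr rfl fun i _ => ?_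
    rw [Real.rpow_def_of_pos (hz i), Real.rpow_def_of_pos (hz i), ← Real.exp_add]
    ring_nf
  have h2 := (dirichletConst_pos hp).ne'
  rw [dirichletDensity, dirichletDensity, h1]
  change dirichletConst _ * _ = _ * (dirichletConst p * _)
  field_simp

/-- Gibbs' inequality: the tilt is maximal at z = p. -/
lemma sum_mul_log_le {z : Fin (n + 1) → ℝ} (hp : ∀ i, 0 < p i) (hp1 : ∑ i, p i = 1)
    (hz : ∀ i, 0 < z i) (hz1 : ∑ i, z i = 1) :
    ∑ i, p i * Real.log (z i) ≤ ∑ i, p i * Real.log (p i) := by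
  have h (i : Fin (n + 1)) : p i * Real.log (z i) - p i * Real.log (p i) ≤ z i - p i := by
    rw [← mul_sub, ← Real.log_div (hz i).ne' (hp i).ne']
    have := mul_le_mul_of_nonneg_left (Real.log_le_sub_one_of_pos (div_pos (hz i) (hp i))) (hp i).le
    rwa [mul_sub, mul_one, mul_div_cancel₀ _ (hp i).ne'] at this
  have := Finset.sum_le_sum fun i (_ : i ∈ Finset.univ) => h i
  rw [Finset.sum_sub_distrib, Finset.sum_sub_distrib, hz1, hp1] at this
  linarith

/-- Both densities have integral 1, and their ratio is at most the constant times the tilt at z = p;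
integrate this bound. -/
lemma exp_le_dirichletConst_div (hp : ∀ i, 0 < p i) (hp1 : ∑ i, p i = 1) {β : ℝ} (hβ : 1 ≤ β)
    (hβp : ∀ i, 1 < β * p i) :
    Real.exp (-((β - 1) * ∑ i, p i * Real.log (p i))) ≤
      dirichletConst (fun i => β * p i) / dirichletConst p := by
  have hα (i : Fin (n + 1)) : 0 < β * p i := one_pos.trans (hβp i)
  set K := dirichletConst (fun i => β * p i) / dirichletConst p
  set H := ∑ i, p i * Real.log (p i)
  have hK : 0 < K := div_pos (dirichletConst_pos hα) (dirichletConst_pos hp)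
  have hle (z : Fin (n + 1) → ℝ) (hz : z ∈ stdSimplex ℝ (Fin (n + 1))) :
      dirichletDensity (fun i => β * p i) z ≤
        K * Real.exp ((β - 1) * H) * dirichletDensity p z := by
    by_cases hpos : ∀ i, 0 < z i
    · rw [dirichletDensity_smul hp hpos]
      have := dirichletDensity_nonneg hp hz.1
      have h1 : 0 ≤ β - 1 := by linarith
      gcongr
      exact sum_mul_log_le hp hp1 hpos hz.2
    -- On the boundary the density is 0 because the exponent β p i - 1 is positive; an exponent 0
    -- would give 0^0 = 1.
    · push Not at hpos
      obtain ⟨i, hi⟩ := hpos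
      have hi0 : z i = 0 := le_antisymm hi (hz.1 i)
      rw [dirichletDensity, Finset.prod_eq_zero (f := fun i => z i ^ _) (Finset.mem_univ i),
        mul_zero]
      · exact mul_nonneg (by positivity) (dirichletDensity_nonneg hp hz.1)
      · rw [hi0, Real.zero_rpow (by linarith [hβp i])]
  have h1 := (isProbabilityMeasure_dirichletDistribution hα).measure_univ
  have h2 := (isProbabilityMeasure_dirichletDistribution hp).measure_univ
  rw [← lintegral_one, lintegral_dirichletDistribution _ measurable_const] at h1 h2
  have h3 : (1 : ℝ≥0∞) ≤ ENNReal.ofReal (K * Real.exp ((β - 1) * H)) * 1 := by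
    rw [← h1]
    -- The previous rewriting also changed the factor 1 on the right, which must be the total mass
    -- of the law with parameters p.
    conv_rhs => rw [h1, ← h2]
    rw [← lintegral_const_mul _ (by fun_prop)]
    refine setLIntegral_mono' (measurableSet_preimage_stdSimplex n) fun x hx => ?_
    rw [mul_one, mul_one, ← ENNReal.ofReal_mul (by positivity)]
    exact ENNReal.ofReal_le_ofReal (hle _ hx)
  rw [mul_one, ENNReal.one_le_ofReal] at h3
  rw [Real.exp_neg, inv_le_iff_one_le_mul₀ (Real.exp_pos _)]
  exact h3

/-- Comparison of two Dirichlet distributions with proportional parameters on a set where the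
relative entropy is bounded. -/
lemma exp_mul_dirichletDistribution_le (hp : ∀ i, 0 < p i) (hp1 : ∑ i, p i = 1) {β : ℝ}
    (hβ : 1 ≤ β) (hβp : ∀ i, 1 < β * p i) {O : Set (Fin (n + 1) → ℝ)} (hO : MeasurableSet O)
    (hO0 : ∀ z ∈ O, ∀ i, 0 < z i) {r : ℝ}
    (hr : ∀ z ∈ O, ∑ i, p i * Real.log (p i / z i) ≤ r) :
    ENNReal.ofReal (Real.exp (-((β - 1) * r))) * dirichletDistribution p O ≤
      dirichletDistribution (fun i => β * p i) O := by
  rw [← lintegral_indicator_one hO, ← lintegral_indicator_one hO,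
    lintegral_dirichletDistribution _ (measurable_one.indicator hO),
    lintegral_dirichletDistribution _ (measurable_one.indicator hO),
    ← lintegral_const_mul _ (by
      exact Measurable.mul (by fun_prop) ((measurable_one.indicator hO).comp (by fun_prop)))]
  refine lintegral_mono fun x => ?_
  by_cases hx : simplexPoint x ∈ O
  swap
  · simp [hx]
  simp only [Set.indicator_of_mem hx, Pi.one_apply, mul_one]
  rw [← ENNReal.ofReal_mul (Real.exp_pos _).le]
  refine ENNReal.ofReal_le_ofReal ?_
  have hz := hO0 _ hx
  rw [dirichletDensity_smul hp hz]
  refine mul_le_mul_of_nonneg_right ?_ (dirichletDensity_nonneg hp fun i => (hz i).le)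
  refine le_trans ?_ (mul_le_mul_of_nonneg_right (exp_le_dirichletConst_div hp hp1 hβ hβp)
    (Real.exp_pos _).le)
  rw [← Real.exp_add, Real.exp_le_exp]
  have h1 := hr _ hx
  simp_rw [fun i => Real.log_div (hp i).ne' (hz i).ne', mul_sub, Finset.sum_sub_distrib] at h1
  have := mul_le_mul_of_nonneg_left h1 (sub_nonneg.2 hβ)
  linarith

/-- In the coordinates of the simplex, O contains a nonempty open set around q on which the density
is positive. -/
lemma dirichletDistribution_pos_of_isOpen {α : Fin (n + 1) → ℝ} (hα : ∀ i, 0 < α i)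
    {O : Set (Fin (n + 1) → ℝ)} (hO : IsOpen O) {q : Fin (n + 1) → ℝ} (hq : q ∈ O)
    (hq0 : ∀ i, 0 < q i) (hq1 : ∑ i, q i = 1) : 0 < dirichletDistribution α O := by
  have hopen : IsOpen (O ∩ {z : Fin (n + 1) → ℝ | ∀ i, 0 < z i}) :=
    hO.inter (by
      simp only [Set.ofPred_forall]
      exact isOpen_iInter_of_finite fun i => isOpen_lt continuous_const (continuous_apply i))
  have hU := (hopen.preimage continuous_simplexPoint).measure_pos volume
    ⟨fun i => q i.castSucc, by
      rw [Set.mem_preimage, simplexPoint_eq hq1]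
      exact ⟨hq, hq0⟩⟩
  rw [← lintegral_indicator_one hO.measurableSet,
    lintegral_dirichletDistribution _ (measurable_one.indicator hO.measurableSet),
    lintegral_pos_iff_support (by
      exact Measurable.mul (by fun_prop)
        ((measurable_one.indicator hO.measurableSet).comp (by fun_prop)))]
  rw [Measure.restrict_apply' (measurableSet_preimage_stdSimplex n)]
  refine hU.trans_le (measure_mono fun x hx => ⟨?_, ?_⟩)
  · have := dirichletDensity_pos hα hx.2
    simp [Set.indicator_of_mem hx.1, this]
  · exact ⟨fun i => (hx.2 i).le, sum_simplexPoint x⟩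

end DirichletLowerBound

/-! ### The lower bound -/

section LowerBound

open InformationTheory

/-- Data processing: test the variational formula with the step function of cell ratios m / ν, whose
ν-integral is 1. -/
lemma sum_mul_log_div_le_klDiv {M : Type*} [MeasurableSpace M] {m ν : Measure M}
    [IsProbabilityMeasure m] [IsProbabilityMeasure ν] (hkl : klDiv m ν ≠ ∞)
    {n : ℕ} {a : M → Fin (n + 1)} (ha : Measurable a) (hpos : ∀ i, 0 < m.real (a ⁻¹' {i}))
    (hposν : ∀ i, 0 < ν.real (a ⁻¹' {i})) :
    ∑ i, m.real (a ⁻¹' {i}) * Real.log (m.real (a ⁻¹' {i}) / ν.real (a ⁻¹' {i})) ≤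
      (klDiv m ν).toReal := by
  let l : Fin (n + 1) → ℝ := fun i => m.real (a ⁻¹' {i}) / ν.real (a ⁻¹' {i})
  obtain ⟨c, C, hc, hlc⟩ := exists_forall_mem_Icc_of_pos (⟨l, by fun_prop⟩ : C(Fin (n + 1), ℝ))
    fun i => div_pos (hpos i) (hposν i)
  have h := integral_log_sub_log_integral_le_klDiv (m := m) (ν := ν) (f := fun x => l (a x))
    ((measurable_of_finite l).comp ha) hc fun x => hlc (a x)
  rw [integral_comp_eq_sum m ha fun i => Real.log (l i), integral_comp_eq_sum ν ha l] at h
  have h1 : ∑ i, l i * ν.real (a ⁻¹' {i}) = 1 := by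
    simp_rw [l, fun i => div_mul_cancel₀ (m.real (a ⁻¹' {i})) (hposν i).ne']
    exact sum_measureReal_fiber m ha
  rw [h1, Real.log_one, sub_zero, ← EReal.coe_ennreal_toReal hkl, EReal.coe_le_coe_iff] at h
  simpa only [mul_comm] using h

variable {M : Type*} [MetricSpace M] [CompactSpace M] [MeasurableSpace M] [BorelSpace M]
  {m : Measure M} [IsProbabilityMeasure m]

/-- The masses of the cells of a sufficiently fine partition determine a probability measure up
to a given neighbourhood. -/
lemma exists_index_forall_mem_of_isOpen [m.IsOpenPosMeasure] {G : Set (ProbabilityMeasure M)}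
    (hG : IsOpen G) {ν : ProbabilityMeasure M} (hν : ν ∈ G) :
    ∃ (n : ℕ) (a : M → Fin (n + 1)) (δ : ℝ), Measurable a ∧ (∀ i, 0 < m.real (a ⁻¹' {i})) ∧
      0 < δ ∧ ∀ ν' : ProbabilityMeasure M,
        (∀ i, |(ν' : Measure M).real (a ⁻¹' {i}) - (ν : Measure M).real (a ⁻¹' {i})| ≤ δ) →
          ν' ∈ G := by
  have : Nonempty M := nonempty_of_isProbabilityMeasure m
  have hG' := hG.preimage (LevyProkhorov.continuous_toMeasure_probabilityMeasure (Ω := M))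
  obtain ⟨ε, hε, hball⟩ := Metric.isOpen_iff.1 hG' (LevyProkhorov.ofMeasure ν) hν
  -- Cells then have diameter at most ε / 4, less than the thickening radius η > ε / 2.
  obtain ⟨n, a, p, ha, hp, hpos⟩ := exists_measurable_index m (ε := ε / 8) (by positivity)
  refine ⟨n, a, ε / 2 / (n + 1), ha, hpos, by positivity, fun ν' hν' => ?_⟩
  refine hball (a := LevyProkhorov.ofMeasure ν') ?_
  rw [Metric.mem_ball, LevyProkhorov.dist_probabilityMeasure_def]
  refine (levyProkhorovDist_le_of_forall_le _ _ (δ := ε / 2) (by positivity)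
    fun η B hη hB => ?_).trans_lt (half_lt_self hε)
  classical
  -- The cells meeting B: their union contains B and lies in the thickening. At most n + 1 cells
  -- with error ε / 2 / (n + 1) each give a total error of at most ε / 2.
  let J : Finset (Fin (n + 1)) := {i | ∃ x ∈ B, a x = i}
  have hsum (ρ : ProbabilityMeasure M) :
      (ρ : Measure M).real (a ⁻¹' J) = ∑ i ∈ J, (ρ : Measure M).real (a ⁻¹' {i}) := by
    rw [← sum_measureReal_preimage_singleton _ fun i _ => ha (measurableSet_singleton i)]
  have h1 : (ν' : Measure M).real B ≤ (ν' : Measure M).real (a ⁻¹' J) :=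
    measureReal_mono fun x hx => by simpa [J] using ⟨x, hx, rfl⟩
  have h2 : (ν : Measure M).real (a ⁻¹' J) ≤ (ν : Measure M).real (Metric.thickening η B) := by
    refine measureReal_mono fun x hx => ?_
    obtain ⟨y, hy, hyx⟩ : ∃ y ∈ B, a y = a x := by simpa [J] using hx
    refine Metric.mem_thickening_iff.2 ⟨y, hy, ?_⟩
    have := dist_triangle_right x y (p (a x))
    have h3 := hp x
    have h4 := hp y
    rw [hyx] at h4
    linarith
  have h3 : ∑ i ∈ J, (ν' : Measure M).real (a ⁻¹' {i}) ≤
      ∑ i ∈ J, (ν : Measure M).real (a ⁻¹' {i}) + ε / 2 := by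
    have h4 := Finset.sum_le_sum fun i (_ : i ∈ J) => (abs_le.1 (hν' i)).2
    rw [Finset.sum_sub_distrib, Finset.sum_const, nsmul_eq_mul] at h4
    have h5 : (J.card : ℝ) * (ε / 2 / (n + 1)) ≤ ε / 2 := by
      have : (J.card : ℝ) ≤ n + 1 := by exact_mod_cast card_finset_fin_le J
      calc (J.card : ℝ) * (ε / 2 / (n + 1)) ≤ (n + 1) * (ε / 2 / (n + 1)) := by gcongr
        _ = ε / 2 := by field_simp
    linarith
  rw [← hsum, ← hsum] at h3
  rw [← ofReal_measureReal (μ := (ν' : Measure M)), ← ofReal_measureReal (μ := (ν : Measure M)),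
    ← ENNReal.ofReal_add measureReal_nonneg (by linarith)]
  exact ENNReal.ofReal_le_ofReal (by linarith)

/-- For ν in G and r > Ent(m|ν), choose an open O around the cell masses q of ν on which ∑ p log (p
/ z) ≤ r. Then Q β G ≥ exp (-(β - 1) r) κ, where κ > 0 is the Dirichlet mass of O for parameters p
and is independent of β. -/
lemma le_liminf_log_measure [m.IsOpenPosMeasure] {Q : ℝ → Measure (ProbabilityMeasure M)}
    (hQ : ∀ β : ℝ, 0 < β → IsDirichletFerguson m β (Q β)) {G : Set (ProbabilityMeasure M)}
    (hG : IsOpen G) :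
    -(⨅ ν ∈ G, (klDiv m (ν : Measure M) : EReal)) ≤
      liminf (fun β : ℝ => ((1 / β : ℝ) : EReal) * ENNReal.log (Q β G)) atTop := by
  rw [EReal.neg_le]
  refine le_iInf₂ fun ν hν => ?_
  by_cases hkl : klDiv m (ν : Measure M) = ∞
  · simp [hkl]
  rw [← EReal.coe_ennreal_toReal hkl]
  refine EReal.le_of_forall_lt_iff_le.1 fun r hr => ?_
  rw [EReal.neg_le, ← EReal.coe_neg]
  rw [EReal.coe_lt_coe_iff] at hr
  obtain ⟨n, a, δ, ha, hpos, hδ, hmem⟩ := exists_index_forall_mem_of_isOpen (m := m) hG hν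
  -- Finite entropy gives m ≪ ν, so ν charges every cell.
  have hposν (i : Fin (n + 1)) : 0 < (ν : Measure M).real (a ⁻¹' {i}) := by
    refine ENNReal.toReal_pos (fun h0 => ?_) (measure_ne_top _ _)
    have := (klDiv_ne_top_iff.1 hkl).1 h0
    exact (hpos i).ne' (by simp [measureReal_def, this])
  have hsum := sum_mul_log_div_le_klDiv hkl ha hpos hposν
  set p : Fin (n + 1) → ℝ := fun i => m.real (a ⁻¹' {i})
  set q : Fin (n + 1) → ℝ := fun i => (ν : Measure M).real (a ⁻¹' {i})
  have hp1 : ∑ i, p i = 1 := sum_measureReal_fiber m ha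
  have hq1 : ∑ i, q i = 1 := sum_measureReal_fiber (ν : Measure M) ha
  have hev : ∀ᶠ z in 𝓝 q, (∀ i, 0 < z i) ∧ (∀ i, |z i - q i| ≤ δ) ∧
      ∑ i, p i * Real.log (p i / z i) ≤ r := by
    have hz (i : Fin (n + 1)) : Tendsto (fun z : Fin (n + 1) → ℝ => z i) (𝓝 q) (𝓝 (q i)) :=
      (continuous_apply i).tendsto q
    refine (eventually_all.2 fun i => (hz i).eventually_const_lt (hposν i)).and
      ((eventually_all.2 fun i => ?_).and ?_)
    · have := ((hz i).sub_const (q i)).abs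
      rw [sub_self, abs_zero] at this
      exact (this.eventually_lt_const hδ).mono fun _ h => h.le
    · have : Tendsto (fun z : Fin (n + 1) → ℝ => ∑ i, p i * Real.log (p i / z i)) (𝓝 q)
          (𝓝 (∑ i, p i * Real.log (p i / q i))) :=
        tendsto_finsetSum _ fun i _ => ((tendsto_const_nhds.div (hz i) (hposν i).ne').log
          (div_pos (hpos i) (hposν i)).ne').const_mul _
      exact (this.eventually_lt_const (hsum.trans_lt hr)).mono fun _ h => h.le
  obtain ⟨O, hOsub, hO, hqO⟩ := mem_nhds_iff.1 hev
  have hκ := dirichletDistribution_pos_of_isOpen hpos hO hqO hposν hq1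
  have := isProbabilityMeasure_dirichletDistribution hpos
  set κ := (dirichletDistribution p).real O
  have hκ0 : 0 < κ := ENNReal.toReal_pos hκ.ne' (measure_ne_top _ _)
  have hbound (β : ℝ) (hβ : 1 ≤ β) (hβp : ∀ i, 1 < β * p i) :
      ENNReal.ofReal (Real.exp (-((β - 1) * r)) * κ) ≤ Q β G := by
    rw [ENNReal.ofReal_mul (Real.exp_pos _).le, ofReal_measureReal]
    refine (exp_mul_dirichletDistribution_le hpos hp1 hβ hβp hO.measurableSet
      (fun z hz => (hOsub hz).1) fun z hz => (hOsub hz).2.2).trans ?_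
    rw [← (hQ β (by linarith)).map_fiber ha hpos, Measure.map_apply
      (measurable_measureReal_partition fun i => ha (measurableSet_singleton i)) hO.measurableSet]
    exact measure_mono fun ν' hν' => hmem ν' (hOsub hν').2.1
  have hlim : Tendsto (fun β : ℝ => ((Real.log κ / β - r + r / β : ℝ) : EReal)) atTop
      (𝓝 ((-r : ℝ) : EReal)) := by
    refine (continuous_coe_real_ereal.tendsto _).comp ?_
    simpa using ((tendsto_id.const_div_atTop (Real.log κ)).sub_const r).add
      (tendsto_id.const_div_atTop r)
  rw [← hlim.liminf_eq]
  refine liminf_le_liminf ?_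
  have hevp : ∀ᶠ β : ℝ in atTop, ∀ i, 1 < β * p i := eventually_all.2 fun i =>
    (tendsto_id.atTop_mul_const (hpos i)).eventually_gt_atTop 1
  filter_upwards [eventually_ge_atTop 1, hevp] with β hβ hβp
  have hβ0 : 0 < β := by linarith
  have h0 : (0 : EReal) ≤ ((1 / β : ℝ) : EReal) := by exact_mod_cast (one_div_pos.2 hβ0).le
  refine le_trans (le_of_eq ?_)
    (mul_le_mul_of_nonneg_left (ENNReal.log_monotone (hbound β hβ hβp)) h0)
  rw [ENNReal.log_ofReal_of_pos (by positivity), Real.log_mul (Real.exp_pos _).ne' hκ0.ne',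
    Real.log_exp, ← EReal.coe_mul]
  congr 1
  field_simp
  ring

end LowerBound

theorem mainTheorem11 {M : Type*} [MetricSpace M] [CompactSpace M] [MeasurableSpace M]
    [BorelSpace M] (m : Measure M) [IsProbabilityMeasure m] [m.IsOpenPosMeasure] :
    (∀ β : ℝ, 0 < β →
      ∃! Q : ProbabilityMeasure (ProbabilityMeasure M),
        IsDirichletFerguson m β (Q : Measure (ProbabilityMeasure M))) ∧
    ∀ Q : ℝ → Measure (ProbabilityMeasure M),
      (∀ β : ℝ, 0 < β → IsDirichletFerguson m β (Q β)) →
      SatisfiesLDP Q (fun ν : ProbabilityMeasure M =>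
        InformationTheory.klDiv m (ν : Measure M)) := by
  refine ⟨fun β hβ => existsUnique_isDirichletFerguson m hβ, fun Q hQ => ⟨?_, ?_, ?_⟩⟩
  · exact lowerSemicontinuous_klDiv m
  · exact fun F hF => limsup_log_measure_le (fun β hβ => (hQ β hβ).satisfiesMarkovKrein hβ) hF
  · exact fun G hG => le_liminf_log_measure hQ hG
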